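/- **Setting.** Let $n_1,\dots,n_m\ge 1$, $n=n_1+\cdots+n_m$, $\pi=(n_1,\dots,n_m)$, and partition $n\times n$ matrices into blocks according to $\pi$. For $i<j$ the pivot submatrix of $X$ is $\widehat X_{ij}=\begin{bmatrix}X_{ii}&X_{ij}\\X_{ji}&X_{jj}\end{bmatrix}$. *Pivot strategies.* A pivot ordering is a sequence containing each pair $(r,s)$, $1\le r<s\le m$, exactly once. Two orderings are equivalent if they differ by finitely many transpositions of adjacent pairs with disjoint index sets; shift-equivalent if they are $[\mathcal O_1,\mathcal O_2]$ and $[\mathcal O_2,\mathcal O_1]$; weakly equivalent if they are joined by a finite chain of equivalences and shift-equivalences; permutation equivalent if one arises from the other by applying one permutation of $\{1,\dots,m\}$ to all indices (each resulting pair being written in increasing order). A serial ordering with permutations is one that goes through the columns $2,\dots,m$ in this order (or through the rows $m-1,\dots,1$ in this order), taking the pairs $(r,j)$, $r<j$, of column $j$ (respectively the pairs $(i,s)$, $s>i$, of row $i$) in any order, or the reverse of such an ordering. $\mathcal O$ is a generalized serial ordering if there are $\mathcal O'$ and a serial ordering with permutations $\mathcal O''$ such that $\mathcal O$ is permutation equivalent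 to $\mathcal O'$ and $\mathcal O'$ weakly equivalent to $\mathcal O''$, or $\mathcal O$ is weakly equivalent to $\mathcal O'$ and $\mathcal O'$ permutation equivalent to $\mathcal O''$. A generalized serial pivot strategy repeats a generalized serial ordering cyclically, $k\mapsto(i(k),j(k))$, $k\ge0$ (so $m\ge 2$). *UBC matrices.* For $0<\varrho\le1$, a unitary matrix $V$ is a UBC elementary block matrix with pivot pair $(i,j)$, $V\in \mathrm{UBCE}_\pi(\varrho)$, if it differs from $I_n$ at most in the blocks $V_{ii},V_{ij},V_{ji},V_{jj}$ and $$\sigma_{\min}(V_{ii})=\sigma_{\min}(V_{jj})\ge\varrho\gamma_{ij},\qquad \gamma_{ij}=\max\Big\{\tfrac{3}{\sqrt{(n_j+1)(4^{n_i}+6n_j-1)}},\tbinom{n_i+n_j}{n_i}^{-1/2}\Big\}.$$ *The method.* Let $A$ be Hermitian, $A^{(0)}=A$ and $A^{(k+1)}=(U^{(k)})^*A^{(k)}U^{(k)}$, $k\ge0$, where $U^{(k)}$ is a unitary matrix that differs from $I_n$ only in the blocks of the pivot pair $(i,j)=(i(k),j(k))$ and whose pivot submatrix $\widehat U^{(k)}_{ij}$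 diagonalizes $\widehat A^{(k)}_{ij}$ by the congruence $X\mapsto (\widehat U^{(k)}_{ij})^*X\,\widehat U^{(k)}_{ij}$. *The core algorithm.* $\widehat U^{(k)}_{ij}=V^{(k)}P^{(k)}$, where $P^{(k)}$ is a permutation matrix and $V^{(k)}$ is delivered by a convergent element-wise complex Jacobi method applied to $\widehat A^{(k)}_{ij}$. That is, there are matrices $S^{(0)}=\widehat A^{(k)}_{ij}$, $S^{(l+1)}=(R^{(l)})^*S^{(l)}R^{(l)}$ converging to a diagonal matrix, where each $R^{(l)}$ is, in some plane $(p,q)$, the rotation $\begin{bmatrix}\cos\phi&-e^{\imath\alpha}\sin\phi\\e^{-\imath\alpha}\sin\phi&\cos\phi\end{bmatrix}$ with $\alpha=\arg s^{(l)}_{pq}$, $-\frac\pi4\le\phi\le\frac\pi4$ and $\tan2\phi=2|s^{(l)}_{pq}|/(s^{(l)}_{pp}-s^{(l)}_{qq})$, read as $(s^{(l)}_{pp}-s^{(l)}_{qq})\sin2\phi=2|s^{(l)}_{pq}|\cos2\phi$; and $V^{(k)}$ is the limit, or more generally a limit point, of the products $R^{(0)}R^{(1)}\cdots R^{(l-1)}$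 as $l\to\infty$. *Attribute R.* The core algorithm has attribute R if each $P^{(k)}$ is obtained as follows. Let $I_{11'}I_{22'}\cdots I_{n_in_i'}$, $r'\ge r$, be the product of the column transpositions made by a QR factorization with column pivoting of the first $n_i$ rows $[V_{ii}\ V_{ij}]$ of $V^{(k)}$. If $\tilde r$ is the smallest $r\le n_i$ with $r'>n_i$, then $P^{(k)}=I_{\tilde r\tilde r'}\cdots I_{n_in_i'}$; if there is no such $r$, then $P^{(k)}=I$. *Affiliation.* A diagonal entry of $A^{(k)}$ is affiliated with an eigenvalue $\lambda$ of $A$ if no eigenvalue of $A$ is nearer to it than $\lambda$. **Theorem.** In this setting (with any generalized serial pivot strategy), let $0<\varrho\le1$ and let $U^{(k)}\in\mathrm{UBCE}_\pi(\varrho)$ with pivot pair $(i(k),j(k))$ for all $k\ge0$. Then: (i) $\lim_{k\to\infty}\mathrm{off}(A^{(k)})=0$, where $\mathrm{off}(X)=\|X-\mathrm{diag}(X)\|_F$. (ii) If the eigenvalues of $A$ are simple and the core algorithm has attribute R, then $\lim_{k\to\infty}A^{(k)}$ exists and is a diagonal matrix of the eigenvalues of $A$ (each with its multiplicity, in some order).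 (iii) If the core algorithm has attribute R and there is $k_0\ge0$ such that, for every $k\ge k_0$ and every multiple eigenvalue $\lambda$ of $A$, all diagonal entries of $A^{(k)}$ affiliated with $\lambda$ lie in one and the same diagonal block, then $\lim_{k\to\infty}A^{(k)}$ exists and is a diagonal matrix of the eigenvalues of $A$ (each with its multiplicity, in some order). -/

import Mathlib

open Filter Topology

noncomputable section

namespace BlockJacobi

/-! ### Pivot orderings and generalized serial strategies

Blocks are numbered by `Fin m`, and a pivot ordering is a list of pairs of block indices. -/

/-- `O` is a pivot ordering: every pair `(r, s)` with `r < s` occurs in it exactly once, and it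
contains nothing else. -/
def IsPivotOrdering {m : ℕ} (O : List (Fin m × Fin m)) : Prop :=
  O.Nodup ∧ ∀ p : Fin m × Fin m, p ∈ O ↔ p.1 < p.2

/-- One admissible transposition: two adjacent pairs with no common index are swapped. -/
def AdmissibleTransposition {m : ℕ} (O O' : List (Fin m × Fin m)) : Prop :=
  ∃ (L R : List (Fin m × Fin m)) (p q : Fin m × Fin m),
    O = L ++ p :: q :: R ∧ O' = L ++ q :: p :: R ∧
      p.1 ≠ q.1 ∧ p.1 ≠ q.2 ∧ p.2 ≠ q.1 ∧ p.2 ≠ q.2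

/-- Equivalence: finitely many admissible transpositions. -/
def OrdEquiv {m : ℕ} (O O' : List (Fin m × Fin m)) : Prop :=
  Relation.ReflTransGen AdmissibleTransposition O O'

/-- Shift-equivalence: `[O₁, O₂]` and `[O₂, O₁]`. -/
def ShiftEquiv {m : ℕ} (O O' : List (Fin m × Fin m)) : Prop :=
  ∃ O₁ O₂ : List (Fin m × Fin m), O = O₁ ++ O₂ ∧ O' = O₂ ++ O₁

/-- Weak equivalence: a finite chain of equivalences and shift-equivalences. -/
def WeakEquiv {m : ℕ} (O O' : List (Fin m × Fin m)) : Prop :=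
  Relation.ReflTransGen (fun a b => OrdEquiv a b ∨ ShiftEquiv a b) O O'

/-- Permutation equivalence: the block indices are relabelled by one permutation `q`. A pivot pair
is the position of a block of a Hermitian matrix, so the relabelled pair is written with its smaller
index first. -/
def PermEquiv {m : ℕ} (O O' : List (Fin m × Fin m)) : Prop :=
  ∃ q : Equiv.Perm (Fin m), O' = O.map fun p => (min (q p.1) (q p.2), max (q p.1) (q p.2))

/-- Column by column, from left to right, in an arbitrary order `τ j` inside column `j`. -/
def ColumnSerial {m : ℕ} (O : List (Fin m × Fin m)) : Prop :=
  ∃ τ : Fin m → List (Fin m), (∀ j, (τ j).Nodup ∧ ∀ r, r ∈ τ j ↔ r < j) ∧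
    O = (List.finRange m).flatMap fun j => (τ j).map fun r => (r, j)

/-- Row by row, from the bottom to the top, in an arbitrary order `τ i` inside row `i`. -/
def RowSerial {m : ℕ} (O : List (Fin m × Fin m)) : Prop :=
  ∃ τ : Fin m → List (Fin m), (∀ i, (τ i).Nodup ∧ ∀ s, s ∈ τ i ↔ i < s) ∧
    O = (List.finRange m).reverse.flatMap fun i => (τ i).map fun s => (i, s)

/-- Serial orderings with permutations: the column and row ones and their reverses. -/
def SerialWithPermutations {m : ℕ} (O : List (Fin m × Fin m)) : Prop :=
  ColumnSerial O ∨ ColumnSerial O.reverse ∨ RowSerial O ∨ RowSerial O.reverse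

/-- Generalized serial pivot orderings. -/
def GeneralizedSerial {m : ℕ} (O : List (Fin m × Fin m)) : Prop :=
  IsPivotOrdering O ∧ ∃ O' O'' : List (Fin m × Fin m), SerialWithPermutations O'' ∧
    ((PermEquiv O O' ∧ WeakEquiv O' O'') ∨ (WeakEquiv O O' ∧ PermEquiv O' O''))

/-- `I` is a generalized serial pivot strategy: it runs cyclically through a generalized serial
pivot ordering. (In particular there is a pivot pair, so `2 ≤ m`.) -/
def IsGeneralizedSerialStrategy {m : ℕ} (I : ℕ → Fin m × Fin m) : Prop :=
  ∃ O : List (Fin m × Fin m), GeneralizedSerial O ∧ ∀ k, O[k % O.length]? = some (I k)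

/-! ### Block matrices -/

/-- Row (and column) indices of a matrix with block partition `(n 0, …, n (m - 1))`: the index
`⟨r, a⟩` is position `a` inside block `r`. -/
abbrev BlockIdx {m : ℕ} (n : Fin m → ℕ) : Type := (r : Fin m) × Fin (n r)

/-- Square complex matrices that carry the block partition `n`. -/
abbrev BlockMatrix {m : ℕ} (n : Fin m → ℕ) : Type := Matrix (BlockIdx n) (BlockIdx n) ℂ

/-- Row indices of the pivot submatrix for the pivot pair `(i, j)`. -/
abbrev PivotIdx {m : ℕ} (n : Fin m → ℕ) (i j : Fin m) : Type := Fin (n i) ⊕ Fin (n j)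

/-- The `(r, s)` block of `V`. -/
def block {m : ℕ} {n : Fin m → ℕ} (V : BlockMatrix n) (r s : Fin m) :
    Matrix (Fin (n r)) (Fin (n s)) ℂ :=
  V.submatrix (fun a => ⟨r, a⟩) (fun b => ⟨s, b⟩)

/-- The pivot submatrix `[V_ii V_ij; V_ji V_jj]`. -/
def pivotSubmatrix {m : ℕ} {n : Fin m → ℕ} (V : BlockMatrix n) (i j : Fin m) :
    Matrix (PivotIdx n i j) (PivotIdx n i j) ℂ :=
  Matrix.fromBlocks (block V i i) (block V i j) (block V j i) (block V j j)

/-- `V` agrees with the identity outside the blocks `(i,i)`, `(i,j)`, `(j,i)`, `(j,j)`. -/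
def IsElementary {m : ℕ} {n : Fin m → ℕ} (i j : Fin m) (V : BlockMatrix n) : Prop :=
  ∀ x y : BlockIdx n, ¬((x.1 = i ∨ x.1 = j) ∧ (y.1 = i ∨ y.1 = j)) →
    V x y = (1 : BlockMatrix n) x y

/-- The smallest singular value of a square matrix of order `p ≥ 1` (singular values are listed in
decreasing order, starting from index `0`). -/
def sigmaMin {p : ℕ} (V : Matrix (Fin p) (Fin p) ℂ) : ℝ :=
  (Matrix.toEuclideanLin V).singularValues (p - 1)

/-- The constant `γ_ij`, as a function of the block sizes `n_i = p` and `n_j = q`. -/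
def ubcGamma (p q : ℕ) : ℝ :=
  max (3 / √(((q : ℝ) + 1) * ((4 : ℝ) ^ p + 6 * (q : ℝ) - 1)))
    (√((Nat.choose (p + q) p : ℕ) : ℝ))⁻¹

/-- `V` is a unitary elementary UBC (uniformly bounded cosine) block matrix with parameter `ϱ` and
pivot pair `(i, j)`. -/
structure IsUBCE {m : ℕ} (n : Fin m → ℕ) (ϱ : ℝ) (i j : Fin m) (V : BlockMatrix n) : Prop where
  unitary : V ∈ Matrix.unitaryGroup (BlockIdx n) ℂ
  elementary : IsElementary i j V
  sigma_eq : sigmaMin (block V i i) = sigmaMin (block V j j)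
  sigma_ge : ϱ * ubcGamma (n i) (n j) ≤ sigmaMin (block V i i)

/-- The off-norm `‖A - diag A‖_F`. -/
def off {ι : Type*} [Fintype ι] [DecidableEq ι] (A : Matrix ι ι ℂ) : ℝ :=
  √(∑ x, ∑ y, ‖(A - Matrix.diagonal A.diag) x y‖ ^ 2)

/-- The block Jacobi method: `Ak 0 = A` and `Ak (k+1) = (U k)ᴴ (Ak k) (U k)`, where `U k` is an
elementary unitary block matrix for the pivot pair `I k` which diagonalizes the pivot submatrix. -/
structure IsBlockJacobi {m : ℕ} (n : Fin m → ℕ) (I : ℕ → Fin m × Fin m) (A : BlockMatrix n)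
    (Ak U : ℕ → BlockMatrix n) : Prop where
  init : Ak 0 = A
  step : ∀ k, Ak (k + 1) = (U k).conjTranspose * Ak k * U k
  unitary : ∀ k, U k ∈ Matrix.unitaryGroup (BlockIdx n) ℂ
  elementary : ∀ k, IsElementary (I k).1 (I k).2 (U k)
  diagonalizes : ∀ k,
    ((pivotSubmatrix (U k) (I k).1 (I k).2).conjTranspose *
      pivotSubmatrix (Ak k) (I k).1 (I k).2 * pivotSubmatrix (U k) (I k).1 (I k).2).IsDiag

/-! ### The core algorithm -/

/-- The complex plane rotation in the `(p, q)` plane: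
`[cos φ, -exp(iα) sin φ; exp(-iα) sin φ, cos φ]`. -/
def rotation {ι : Type*} [DecidableEq ι] (p q : ι) (α φ : ℝ) : Matrix ι ι ℂ :=
  Matrix.of fun x y =>
    if x = p ∧ y = p then (Real.cos φ : ℂ)
    else if x = p ∧ y = q then -(Complex.exp (α * Complex.I) * (Real.sin φ : ℂ))
    else if x = q ∧ y = p then Complex.exp (-(α * Complex.I)) * (Real.sin φ : ℂ)
    else if x = q ∧ y = q then (Real.cos φ : ℂ)
    else (1 : Matrix ι ι ℂ) x y

/-- `R` is a complex Jacobi rotation for `S`: for some pivot position `(p, q)` it is the rotation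
with `α = arg S_pq`, `tan 2φ = 2|S_pq| / (S_pp - S_qq)` and `-π/4 ≤ φ ≤ π/4`. The equation for the
angle is written without the quotient, so that `S_pp = S_qq ≠ S_pq` gives `φ = ± π/4`. -/
def IsJacobiRotation {ι : Type*} [DecidableEq ι] (S R : Matrix ι ι ℂ) : Prop :=
  ∃ (p q : ι) (φ : ℝ), p ≠ q ∧ -(Real.pi / 4) ≤ φ ∧ φ ≤ Real.pi / 4 ∧
    Real.sin (2 * φ) * ((S p p).re - (S q q).re) = 2 * ‖S p q‖ * Real.cos (2 * φ) ∧
    R = rotation p q (Complex.arg (S p q)) φ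

/-- A convergent run of an element-wise complex Jacobi method on `B` delivers the diagonalizing
matrix `V`: the iterates converge to a diagonal matrix, and `V` is the limit of the accumulated
products of rotations or, where these products do not converge (which can happen if `B` has
multiple eigenvalues), one of their limit points. -/
def IsCoreOutput {ι : Type*} [Fintype ι] [DecidableEq ι] (B V : Matrix ι ι ℂ) : Prop :=
  ∃ S R : ℕ → Matrix ι ι ℂ, S 0 = B ∧
    (∀ l, IsJacobiRotation (S l) (R l) ∧ S (l + 1) = (R l).conjTranspose * S l * R l) ∧
    (∃ d : ι → ℂ, Tendsto S atTop (𝓝 (Matrix.diagonal d))) ∧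
    MapClusterPt V atTop fun l => ((List.range l).map R).prod

/-! ### Column pivoting and attribute R

The columns of the pivot submatrix are numbered by `Fin p ⊕ Fin q`, the first `p` of them being
those of the form `Sum.inl r`. A family `t : Fin p → Fin p ⊕ Fin q` records, for every step
`r` of the QR algorithm, the column `r' = t r` which is swapped with column `r`. -/

/-- The product of the transposition matrices `I_{r r'}` over the list `L` of steps. -/
def swapProduct {p q : ℕ} (t : Fin p → Fin p ⊕ Fin q) (L : List (Fin p)) :
    Matrix (Fin p ⊕ Fin q) (Fin p ⊕ Fin q) ℂ :=
  (L.map fun r => Matrix.swap ℂ (Sum.inl r) (t r)).prod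

/-- `t` is the list of column swaps of a QR factorization with column pivoting of the first `p` rows
`[V_ii V_ij]` of `V`. With `P = I_{11'} I_{22'} ⋯`, we have `[V_ii V_ij] P = Q T` with `Q` unitary and
`T` upper trapezoidal; and in step `r` the pivot column, among the columns not yet processed, is one
whose part in the rows `r, …, p` has the largest norm. -/
def IsColumnPivoting {p q : ℕ} (V : Matrix (Fin p ⊕ Fin q) (Fin p ⊕ Fin q) ℂ)
    (t : Fin p → Fin p ⊕ Fin q) : Prop :=
  (∀ r s : Fin p, t r = Sum.inl s → r ≤ s) ∧
  ∃ (Q : Matrix (Fin p) (Fin p) ℂ) (T : Matrix (Fin p) (Fin p ⊕ Fin q) ℂ),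
    Q ∈ Matrix.unitaryGroup (Fin p) ℂ ∧
    V.submatrix Sum.inl id * swapProduct t (List.finRange p) = Q * T ∧
    (∀ r s : Fin p, r < s → T s (Sum.inl r) = 0) ∧
    ∀ (r : Fin p) (c : Fin p ⊕ Fin q), (∀ s : Fin p, c = Sum.inl s → r ≤ s) →
      ∑ s ∈ Finset.Ici r, ‖T s c‖ ^ 2 ≤ ‖T r (Sum.inl r)‖ ^ 2

/-- The matrix `P` by which the columns of `V` are permuted obeys attribute R: instead of the full
product `I_{11'} I_{22'} ⋯ I_{pp'}` of a QR factorization with column pivoting, one takes the product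
that starts at the first step `r` with `r' > p` (and the identity if there is no such step). -/
def HasAttributeR {p q : ℕ} (V P : Matrix (Fin p ⊕ Fin q) (Fin p ⊕ Fin q) ℂ) : Prop :=
  ∃ t : Fin p → Fin p ⊕ Fin q, IsColumnPivoting V t ∧
    P = swapProduct t ((List.finRange p).dropWhile fun r => (t r).isLeft)

/-! ### Eigenvalues -/

/-- The real number `μ` is a multiple eigenvalue of the Hermitian matrix `A`. -/
def IsMultipleEigenvalue {ι : Type*} [Fintype ι] [DecidableEq ι] {A : Matrix ι ι ℂ}
    (hA : A.IsHermitian) (μ : ℝ) : Prop :=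
  ∃ x y : ι, x ≠ y ∧ hA.eigenvalues x = μ ∧ hA.eigenvalues y = μ

/-- The number `a` (a diagonal entry of an iterate) is affiliated with the eigenvalue `μ` of `A`:
no eigenvalue of `A` is nearer to `a` than `μ` is. -/
def IsAffiliated {ι : Type*} [Fintype ι] [DecidableEq ι] {A : Matrix ι ι ℂ}
    (hA : A.IsHermitian) (a : ℂ) (μ : ℝ) : Prop :=
  (∃ x, hA.eigenvalues x = μ) ∧ ∀ x, ‖a - (μ : ℂ)‖ ≤ ‖a - (hA.eigenvalues x : ℂ)‖

/-- `Ak` converges to a diagonal matrix of the eigenvalues of `A`, each repeated according to its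
multiplicity, in some order. -/
def ConvergesToEigenvalues {ι : Type*} [Fintype ι] [DecidableEq ι] {A : Matrix ι ι ℂ}
    (hA : A.IsHermitian) (Ak : ℕ → Matrix ι ι ℂ) : Prop :=
  ∃ σ : Equiv.Perm ι,
    Tendsto Ak atTop (𝓝 (Matrix.diagonal fun x => (hA.eigenvalues (σ x) : ℂ)))

end BlockJacobi

end

/-!
A step of the block Jacobi process lowers `off²` by exactly `off²` of its pivot submatrix
(`ActsOn.off_sq_conj_add`). Convergence of the off-norm to zero is therefore a matter of excluding
nontrivial limits. Along an ultrafilter the iterates and the transformations, observed from the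
beginnings of the cycles on, converge to a *stationary* process: every pivot submatrix is already
diagonal before its step, and the bound on `σ_min` makes the diagonal blocks of all limit
transformations nonsingular. Stationary steps are symmetric in time, commute when their pivot pairs
are disjoint, preserve diagonality in both directions and do not see how the blocks are labelled;
so the set of orderings whose cyclic repetition admits only diagonal stationary processes
(`ForcesDiagonal`) is closed under equivalence, shift-equivalence and permutation equivalence. For
a serial ordering it is enough to follow one cycle: before the turn of the pair `(r, j)`, the block
in that position is only multiplied by nonsingular blocks, and at its turn it is zero, so it was
zero at the beginning of column `j` (`StationaryRun.column_eq_zero`).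

Once the iterate is almost diagonal, compactness shows that its diagonal is close to a
rearrangement of the eigenvalues (`exists_perm_near_of_off_le`). A Jacobi rotation with angle in
`[-π/4, π/4]` moves a diagonal entry by at most the modulus of the annihilated entry, which is less
than the gap between distinct eigenvalues, so the core algorithm leaves every diagonal entry at its
eigenvalue (`IsCoreOutput.exists_diagonal`). If entries at a multiple eigenvalue share one block,
the two pivot blocks belong to disjoint sets of eigenvalues; then `V_ij` is small, column pivoting
selects no column of the second block, and attribute R yields `P = I` (`HasAttributeR.eq_one`).
Hence the assignment of diagonal entries to eigenvalues is eventually constant, and the iterates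
converge. For simple eigenvalues the condition on multiple eigenvalues is vacuous.
-/

set_option linter.unusedSectionVars false

namespace BlockJacobi

open Matrix

/-! ### Sums of squares and unitary congruences -/

section Frobenius

variable {ι κ : Type*} [Fintype ι] [DecidableEq ι] [Fintype κ] [DecidableEq κ]

/-- The square of the Frobenius norm. -/
noncomputable def frobSq (B : Matrix ι ι ℂ) : ℝ := ∑ x, ∑ y, ‖B x y‖ ^ 2

/-- The sum of the squared moduli of the diagonal entries. -/
noncomputable def diagSq (B : Matrix ι ι ℂ) : ℝ := ∑ x, ‖B x x‖ ^ 2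

theorem off_sq (B : Matrix ι ι ℂ) : off B ^ 2 = frobSq B - diagSq B := by
  rw [off, Real.sq_sqrt (by positivity), frobSq, diagSq, ← Finset.sum_sub_distrib]
  refine Finset.sum_congr rfl fun x _ => ?_
  rw [← Finset.add_sum_erase _ _ (Finset.mem_univ x),
    ← Finset.add_sum_erase Finset.univ (fun y => ‖B x y‖ ^ 2) (Finset.mem_univ x)]
  have : ∀ y ∈ Finset.univ.erase x, ‖(B - diagonal B.diag) x y‖ ^ 2 = ‖B x y‖ ^ 2 := by
    intro y hy
    rw [Matrix.sub_apply, diagonal_apply_ne _ (Finset.ne_of_mem_erase hy).symm, sub_zero]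
  rw [Finset.sum_congr rfl this]
  simp

theorem off_nonneg (B : Matrix ι ι ℂ) : 0 ≤ off B := Real.sqrt_nonneg _

theorem off_sq_eq_sum (B : Matrix ι ι ℂ) :
    off B ^ 2 = ∑ x, ∑ y, if x = y then 0 else ‖B x y‖ ^ 2 := by
  rw [off, Real.sq_sqrt (by positivity)]
  refine Finset.sum_congr rfl fun x _ => Finset.sum_congr rfl fun y _ => ?_
  by_cases h : x = y
  · subst h; simp
  · simp [h]

theorem norm_le_off {B : Matrix ι ι ℂ} {x y : ι} (h : x ≠ y) : ‖B x y‖ ≤ off B := by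
  refine le_of_sq_le_sq ?_ (off_nonneg B)
  rw [off_sq_eq_sum]
  calc ‖B x y‖ ^ 2 = if x = y then 0 else ‖B x y‖ ^ 2 := by simp [h]
    _ ≤ ∑ y, if x = y then 0 else ‖B x y‖ ^ 2 :=
      Finset.single_le_sum (f := fun y => if x = y then (0 : ℝ) else ‖B x y‖ ^ 2)
        (fun _ _ => by positivity) (Finset.mem_univ y)
    _ ≤ _ := Finset.single_le_sum (f := fun x => ∑ y, if x = y then (0 : ℝ) else ‖B x y‖ ^ 2)
        (fun _ _ => by positivity) (Finset.mem_univ x)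

theorem isDiag_of_off_eq_zero {B : Matrix ι ι ℂ} (h : off B = 0) : B.IsDiag := fun x y hxy => by
  have := norm_le_off (B := B) hxy
  rw [h] at this
  simpa using this

theorem off_eq_zero_of_isDiag {B : Matrix ι ι ℂ} (h : B.IsDiag) : off B = 0 := by
  rw [← sq_eq_zero_iff, off_sq_eq_sum]
  refine Finset.sum_eq_zero fun x _ => Finset.sum_eq_zero fun y _ => ?_
  split_ifs with hxy
  · rfl
  · simp [h hxy]

theorem norm_entry_sq_le_frobSq (B : Matrix ι ι ℂ) (x y : ι) : ‖B x y‖ ^ 2 ≤ frobSq B :=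
  (Finset.single_le_sum (f := fun y => ‖B x y‖ ^ 2) (fun _ _ => by positivity)
    (Finset.mem_univ y)).trans
    (Finset.single_le_sum (f := fun x => ∑ y, ‖B x y‖ ^ 2) (fun _ _ => by positivity)
      (Finset.mem_univ x))

theorem frobSq_eq_trace (B : Matrix ι ι ℂ) : (frobSq B : ℂ) = (B * Bᴴ).trace := by
  simp only [frobSq, trace, diag_apply, mul_apply, conjTranspose_apply, Complex.ofReal_sum]
  refine Finset.sum_congr rfl fun x _ => Finset.sum_congr rfl fun y _ => ?_
  rw [RCLike.star_def, Complex.mul_conj', Complex.ofReal_pow]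

theorem frobSq_conj {W : Matrix ι ι ℂ} (hW : W ∈ unitaryGroup ι ℂ) (B : Matrix ι ι ℂ) :
    frobSq (Wᴴ * B * W) = frobSq B := by
  have h1 : W * Wᴴ = 1 := mem_unitaryGroup_iff.1 hW
  have : (frobSq (Wᴴ * B * W) : ℂ) = frobSq B := by
    rw [frobSq_eq_trace, frobSq_eq_trace]
    calc (Wᴴ * B * W * (Wᴴ * B * W)ᴴ).trace
        = (Wᴴ * (B * (W * Wᴴ) * Bᴴ * W)).trace := by
          simp only [conjTranspose_mul, conjTranspose_conjTranspose, Matrix.mul_assoc]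
      _ = (B * (W * Wᴴ) * Bᴴ * (W * Wᴴ)).trace := by
          rw [trace_mul_comm]; simp only [Matrix.mul_assoc]
      _ = (B * Bᴴ).trace := by rw [h1]; simp
  exact_mod_cast this

theorem charpoly_conj {W : Matrix ι ι ℂ} (hW : W ∈ unitaryGroup ι ℂ) (B : Matrix ι ι ℂ) :
    (Wᴴ * B * W).charpoly = B.charpoly := by
  have h1 : W * Wᴴ = 1 := mem_unitaryGroup_iff.1 hW
  rw [Matrix.mul_assoc, charpoly_mul_comm, Matrix.mul_assoc, h1, Matrix.mul_one]

theorem isHermitian_conj {B : Matrix ι ι ℂ} (hB : B.IsHermitian) (W : Matrix ι ι ℂ) :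
    (Wᴴ * B * W).IsHermitian := isHermitian_conjTranspose_mul_mul W hB

theorem conjTranspose_mem_unitaryGroup {W : Matrix ι ι ℂ} (hW : W ∈ unitaryGroup ι ℂ) :
    Wᴴ ∈ unitaryGroup ι ℂ := Unitary.star_mem hW

/-! ### Matrices that act on a subset of the coordinates -/

/-- `W` agrees with the identity outside the rows and columns in `s`. For the elementary matrices of
a pivot pair, `s` is the range of the injection `e` of the pivot indices, and the pivot submatrix of
`B` is `B.submatrix e e`. -/
def ActsOn (s : Set ι) (W : Matrix ι ι ℂ) : Prop :=
  ∀ x y, ¬(x ∈ s ∧ y ∈ s) → W x y = (1 : Matrix ι ι ℂ) x y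

theorem ActsOn.conjTranspose {s : Set ι} {W : Matrix ι ι ℂ} (h : ActsOn s W) : ActsOn s Wᴴ := by
  intro x y hxy
  rw [conjTranspose_apply, h y x (fun h' => hxy ⟨h'.2, h'.1⟩), ← conjTranspose_apply,
    conjTranspose_one]

theorem ActsOn.mul_submatrix {e : κ → ι} (he : Function.Injective e) {W : Matrix ι ι ℂ}
    (h : ActsOn (Set.range e) W) {o : Type*} (B : Matrix ι ι ℂ) (f : o → ι) :
    (B * W).submatrix f e = B.submatrix f e * W.submatrix e e := by
  ext x y
  simp only [submatrix_apply, mul_apply]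
  rw [← Finset.sum_subset (Finset.subset_univ (Finset.univ.map ⟨e, he⟩)), Finset.sum_map]
  · rfl
  · intro z _ hz
    have hz' : z ∉ Set.range e := by simpa using hz
    rw [h _ _ (fun h' => hz' h'.1), one_apply_ne, mul_zero]
    rintro rfl
    exact hz' ⟨y, rfl⟩

theorem ActsOn.conj_submatrix {e : κ → ι} (he : Function.Injective e) {W : Matrix ι ι ℂ}
    (h : ActsOn (Set.range e) W) (B : Matrix ι ι ℂ) :
    (Wᴴ * B * W).submatrix e e
      = (W.submatrix e e)ᴴ * B.submatrix e e * W.submatrix e e := by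
  have h1 : (Wᴴ * B).submatrix e e = (W.submatrix e e)ᴴ * B.submatrix e e := by
    have := congrArg Matrix.conjTranspose (h.mul_submatrix he Bᴴ e)
    rwa [conjTranspose_submatrix, conjTranspose_mul, conjTranspose_mul, conjTranspose_submatrix,
      conjTranspose_submatrix, conjTranspose_conjTranspose, ← conjTranspose_submatrix] at this
  rw [h.mul_submatrix he, h1]

theorem ActsOn.submatrix_mem_unitaryGroup {e : κ → ι} (he : Function.Injective e)
    {W : Matrix ι ι ℂ} (h : ActsOn (Set.range e) W) (hW : W ∈ unitaryGroup ι ℂ) :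
    W.submatrix e e ∈ unitaryGroup κ ℂ := by
  have := h.conj_submatrix he 1
  rw [Matrix.mul_one, ← star_eq_conjTranspose, mem_unitaryGroup_iff'.1 hW, submatrix_one _ he,
    Matrix.mul_one] at this
  exact mem_unitaryGroup_iff'.2 this.symm

theorem ActsOn.mul_apply_of_notMem {s : Set ι} {W : Matrix ι ι ℂ}
    (h : ActsOn s W) (B : Matrix ι ι ℂ) (x : ι) {y : ι} (hy : y ∉ s) :
    (B * W) x y = B x y := by
  rw [mul_apply, Finset.sum_eq_single y]
  · rw [h _ _ (fun h' => hy h'.2), one_apply_eq, mul_one]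
  · intro z _ hz
    rw [h _ _ (fun h' => hy h'.2), one_apply_ne hz, mul_zero]
  · simp

theorem ActsOn.conjTranspose_mul_apply_of_notMem {s : Set ι} {W : Matrix ι ι ℂ}
    (h : ActsOn s W) (B : Matrix ι ι ℂ) {x : ι} (y : ι) (hx : x ∉ s) :
    (Wᴴ * B) x y = B x y := by
  rw [← conjTranspose_conjTranspose (Wᴴ * B), conjTranspose_apply,
    conjTranspose_mul, conjTranspose_conjTranspose, h.mul_apply_of_notMem _ _ hx,
    conjTranspose_apply, star_star]

theorem ActsOn.conj_apply_of_notMem {s : Set ι} {W : Matrix ι ι ℂ}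
    (h : ActsOn s W) (B : Matrix ι ι ℂ) {x y : ι} (hx : x ∉ s) (hy : y ∉ s) :
    (Wᴴ * B * W) x y = B x y := by
  rw [h.mul_apply_of_notMem _ _ hy, h.conjTranspose_mul_apply_of_notMem _ _ hx]

theorem diagSq_split {e : κ → ι} (he : Function.Injective e) (B : Matrix ι ι ℂ) :
    diagSq B = diagSq (B.submatrix e e)
      + ∑ x ∈ (Finset.univ.map ⟨e, he⟩)ᶜ, ‖B x x‖ ^ 2 := by
  rw [diagSq, ← Finset.sum_add_sum_compl (Finset.univ.map ⟨e, he⟩), Finset.sum_map]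
  rfl

/-- Diagonalizing a pivot submatrix decreases `off²` of the whole matrix by exactly `off²` of the
pivot submatrix. -/
theorem ActsOn.off_sq_conj_add {e : κ → ι} (he : Function.Injective e) {W : Matrix ι ι ℂ}
    (h : ActsOn (Set.range e) W) (hW : W ∈ unitaryGroup ι ℂ) (B : Matrix ι ι ℂ)
    (hd : ((Wᴴ * B * W).submatrix e e).IsDiag) :
    off (Wᴴ * B * W) ^ 2 + off (B.submatrix e e) ^ 2 = off B ^ 2 := by
  have h1 : diagSq ((Wᴴ * B * W).submatrix e e) = frobSq (B.submatrix e e) := by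
    have h2 := off_sq ((Wᴴ * B * W).submatrix e e)
    rw [off_eq_zero_of_isDiag hd, h.conj_submatrix he,
      frobSq_conj (h.submatrix_mem_unitaryGroup he hW)] at h2
    rw [h.conj_submatrix he]
    linarith
  have h3 : ∑ x ∈ (Finset.univ.map ⟨e, he⟩)ᶜ, ‖(Wᴴ * B * W) x x‖ ^ 2
      = ∑ x ∈ (Finset.univ.map ⟨e, he⟩)ᶜ, ‖B x x‖ ^ 2 := by
    refine Finset.sum_congr rfl fun x hx => ?_
    have hx' : x ∉ Set.range e := by simpa using hx
    rw [h.conj_apply_of_notMem _ hx' hx']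
  rw [off_sq, off_sq, off_sq, frobSq_conj hW, diagSq_split he (Wᴴ * B * W), diagSq_split he B, h1,
    h3]
  ring

end Frobenius

/-! ### Stationary runs -/

section Stationary

variable {ι : Type*} [Fintype ι] [DecidableEq ι] {m : ℕ}

/-- The indices in the two blocks of the pivot pair `p`, where `b x` is the block of `x`. -/
def pivotSet (b : ι → Fin m) (p : Fin m × Fin m) : Set ι := {x | b x = p.1 ∨ b x = p.2}

/-- The diagonal block `W_rr` is nonsingular: a row vector `v` that lives in block `r` and satisfies
`v W_rr = 0` is zero. -/
def NonsingularBlock (b : ι → Fin m) (r : Fin m) (W : Matrix ι ι ℂ) : Prop :=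
  ∀ v : ι → ℂ, (∀ z, b z ≠ r → v z = 0) → (∀ y, b y = r → (v ᵥ* W) y = 0) → v = 0

/-- The principal submatrix of `B` on `s` is diagonal. -/
def DiagOn (s : Set ι) (B : Matrix ι ι ℂ) : Prop := ∀ x ∈ s, ∀ y ∈ s, x ≠ y → B x y = 0

/-- The blocks `B_rs` with `r ≠ s` in `S` vanish. -/
def BlockDiagOn (b : ι → Fin m) (S : Set (Fin m)) (B : Matrix ι ι ℂ) : Prop :=
  ∀ x y, b x ∈ S → b y ∈ S → b x ≠ b y → B x y = 0

/-- A step of the block Jacobi method whose pivot submatrix is diagonal beforehand as well, made by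
a unitary matrix with nonsingular diagonal blocks. All steps of a limit of the process are of this
kind, since `off` is constant along the limit. Both `W` and `Wᴴ` appear in the condition, which
makes the relation symmetric in `B` and `B'`. -/
structure StationaryStep (b : ι → Fin m) (p : Fin m × Fin m) (B B' : Matrix ι ι ℂ) : Prop where
  herm : B.IsHermitian
  diag : DiagOn (pivotSet b p) B
  diag' : DiagOn (pivotSet b p) B'
  exists_conj : ∃ W ∈ unitaryGroup ι ℂ, ActsOn (pivotSet b p) W ∧
    (∀ r, r = p.1 ∨ r = p.2 → NonsingularBlock b r W ∧ NonsingularBlock b r Wᴴ) ∧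
    B' = Wᴴ * B * W

/-- Stationary steps for the consecutive pivot pairs of a list. -/
def StationaryRun (b : ι → Fin m) : List (Fin m × Fin m) → Matrix ι ι ℂ → Matrix ι ι ℂ → Prop
  | [], B, B' => B = B'
  | p :: O, B, B' => ∃ C, StationaryStep b p B C ∧ StationaryRun b O C B'

variable {b : ι → Fin m} {p q : Fin m × Fin m} {B B' : Matrix ι ι ℂ}

theorem StationaryStep.herm' (h : StationaryStep b p B B') : B'.IsHermitian := by
  obtain ⟨W, -, -, -, rfl⟩ := h.exists_conj
  exact isHermitian_conj h.herm W

theorem StationaryStep.symm (h : StationaryStep b p B B') : StationaryStep b p B' B := by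
  refine ⟨h.herm', h.diag', h.diag, ?_⟩
  obtain ⟨W, hW, hs, hn, rfl⟩ := h.exists_conj
  refine ⟨Wᴴ, conjTranspose_mem_unitaryGroup hW, hs.conjTranspose, fun r hr => ?_, ?_⟩
  · rw [conjTranspose_conjTranspose]
    exact (hn r hr).symm
  · have h1 : W * Wᴴ = 1 := mem_unitaryGroup_iff.1 hW
    rw [conjTranspose_conjTranspose]
    calc B = (W * Wᴴ) * B * (W * Wᴴ) := by rw [h1]; simp
      _ = W * (Wᴴ * B * W) * Wᴴ := by simp only [Matrix.mul_assoc]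

theorem StationaryStep.apply_of_notMem (h : StationaryStep b p B B') {x y : ι}
    (hx : x ∉ pivotSet b p) (hy : y ∉ pivotSet b p) : B' x y = B x y := by
  obtain ⟨W, -, hs, -, rfl⟩ := h.exists_conj
  exact hs.conj_apply_of_notMem B hx hy

theorem StationaryStep.diagOn_block (h : StationaryStep b p B B') (r : Fin m)
    (hB : DiagOn {x | b x = r} B) : DiagOn {x | b x = r} B' := by
  intro x hx y hy hxy
  by_cases hr : r = p.1 ∨ r = p.2
  · exact h.diag' x (by rwa [← show b x = r from hx] at hr) y
      (by rwa [← show b y = r from hy] at hr) hxy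
  · rw [h.apply_of_notMem (fun h' => hr (by rwa [← show b x = r from hx]))
      (fun h' => hr (by rwa [← show b y = r from hy]))]
    exact hB x hx y hy hxy

theorem StationaryStep.blockDiagOn (h : StationaryStep b p B B') {S : Set (Fin m)}
    (h1 : p.1 ∈ S) (h2 : p.2 ∈ S) (hB : BlockDiagOn b S B) : BlockDiagOn b S B' := by
  have key : ∀ x y, x ∈ pivotSet b p → y ∉ pivotSet b p → b y ∈ S → B' x y = 0 := by
    intro x y hx hy hyS
    obtain ⟨W, -, hs, -, rfl⟩ := h.exists_conj
    rw [hs.mul_apply_of_notMem _ _ hy, mul_apply]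
    refine Finset.sum_eq_zero fun z _ => ?_
    by_cases hz : z ∈ pivotSet b p
    · rw [hB z y _ hyS _, mul_zero]
      · rcases hz with hz | hz <;> rwa [hz]
      · intro hzy
        exact hy (by rcases hz with hz | hz <;> rw [hzy] at hz <;> simp [pivotSet, hz])
    · rw [hs.conjTranspose _ _ (fun h' => hz h'.2), one_apply_ne, zero_mul]
      rintro rfl
      exact hz hx
  intro x y hxS hyS hxy
  by_cases hx : x ∈ pivotSet b p <;> by_cases hy : y ∈ pivotSet b p
  · exact h.diag' x hx y hy (fun h' => hxy (h' ▸ rfl))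
  · exact key x y hx hy hyS
  · rw [← h.herm'.apply, key y x hy hx hxS, star_zero]
  · rw [h.apply_of_notMem hx hy, hB x y hxS hyS hxy]

theorem isDiag_iff_blocks (b : ι → Fin m) (B : Matrix ι ι ℂ) :
    B.IsDiag ↔ BlockDiagOn b Set.univ B ∧ ∀ r, DiagOn {x | b x = r} B := by
  constructor
  · exact fun h => ⟨fun x y _ _ hxy => h (fun h' => hxy (h' ▸ rfl)), fun r x _ y _ hxy => h hxy⟩
  · rintro ⟨h1, h2⟩ x y hxy
    by_cases hb : b x = b y
    · exact h2 (b y) x hb y rfl hxy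
    · exact h1 x y trivial trivial hb

theorem StationaryStep.isDiag (h : StationaryStep b p B B') (hB : B.IsDiag) : B'.IsDiag := by
  rw [isDiag_iff_blocks b] at hB ⊢
  exact ⟨h.blockDiagOn trivial trivial hB.1, fun r => h.diagOn_block r (hB.2 r)⟩

theorem stationaryRun_append {O₁ O₂ : List (Fin m × Fin m)} :
    StationaryRun b (O₁ ++ O₂) B B' ↔ ∃ C, StationaryRun b O₁ B C ∧ StationaryRun b O₂ C B' := by
  induction O₁ generalizing B with
  | nil => simp [StationaryRun]
  | cons p O ih =>
    simp only [List.cons_append, StationaryRun, ih]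
    constructor
    · rintro ⟨C, h1, D, h2, h3⟩
      exact ⟨D, ⟨C, h1, h2⟩, h3⟩
    · rintro ⟨D, ⟨C, h1, h2⟩, h3⟩
      exact ⟨C, h1, D, h2, h3⟩

theorem StationaryRun.reverse {O : List (Fin m × Fin m)} (h : StationaryRun b O B B') :
    StationaryRun b O.reverse B' B := by
  induction O generalizing B with
  | nil => exact Eq.symm h
  | cons p O ih =>
    obtain ⟨C, h1, h2⟩ := h
    rw [List.reverse_cons, stationaryRun_append]
    exact ⟨C, ih h2, B, h1.symm, rfl⟩

theorem StationaryRun.isDiag {O : List (Fin m × Fin m)} (h : StationaryRun b O B B')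
    (hB : B.IsDiag) : B'.IsDiag := by
  induction O generalizing B with
  | nil => exact (show B = B' from h) ▸ hB
  | cons p O ih =>
    obtain ⟨C, h1, h2⟩ := h
    exact ih h2 (h1.isDiag hB)

theorem StationaryRun.isDiag_left {O : List (Fin m × Fin m)} (h : StationaryRun b O B B')
    (hB : B'.IsDiag) : B.IsDiag := h.reverse.isDiag hB

theorem StationaryRun.diagOn_block {O : List (Fin m × Fin m)} (h : StationaryRun b O B B')
    {r : Fin m} (hp : p ∈ O) (hr : r = p.1 ∨ r = p.2) : DiagOn {x | b x = r} B' := by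
  have mono : ∀ {O : List (Fin m × Fin m)} {B : Matrix ι ι ℂ}, StationaryRun b O B B' →
      DiagOn {x | b x = r} B → DiagOn {x | b x = r} B' := by
    intro O
    induction O with
    | nil => exact fun h hB => (show _ = B' from h) ▸ hB
    | cons p O ih => exact fun ⟨C, h1, h2⟩ hB => ih h2 (h1.diagOn_block r hB)
  obtain ⟨O₁, O₂, rfl⟩ := List.append_of_mem hp
  obtain ⟨C, -, D, h1, h2⟩ := stationaryRun_append.1 h
  refine mono h2 fun x hx y hy hxy => h1.diag' x ?_ y ?_ hxy
  · rwa [← show b x = r from hx] at hr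
  · rwa [← show b y = r from hy] at hr

/-! ### Serial orderings force a diagonal matrix -/

/-- Suppose that the blocks in `l` are mutually decoupled. A stationary run through the pairs of
column `j` shows that they were also decoupled from block `j`: until the pair `(r, j)` is reached,
the block in this position is only multiplied from the right by nonsingular blocks `W_jj`, and it is
zero when `(r, j)` is the pivot. The pairs may be written in either order. -/
theorem StationaryRun.column_eq_zero {j : Fin m} (f : Fin m → Fin m × Fin m)
    (hf : ∀ r, f r = (r, j) ∨ f r = (j, r)) (l : List (Fin m)) (hl : l.Nodup) (hj : j ∉ l)
    (h : StationaryRun b (l.map f) B B') (hB : BlockDiagOn b {r | r ∈ l} B) :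
    ∀ x y, b x ∈ l → b y = j → B x y = 0 := by
  induction l generalizing B with
  | nil => simp
  | cons s l ih =>
    obtain ⟨C, h1, h2⟩ := h
    have hs : pivotSet b (f s) = {x | b x = s ∨ b x = j} := by
      rcases hf s with hs | hs <;> ext x <;> simp [pivotSet, hs, or_comm]
    rw [List.nodup_cons] at hl
    simp only [List.mem_cons, not_or] at hj
    have hC : ∀ x y, b x ∈ l → b y = j → C x y = 0 := by
      refine ih hl.2 hj.2 h2 fun x y hx hy hxy => ?_
      have hx' : x ∉ pivotSet b (f s) := by
        rw [hs]
        rintro (h' | h')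
        · exact hl.1 (h' ▸ hx)
        · exact hj.2 (h' ▸ hx)
      have hy' : y ∉ pivotSet b (f s) := by
        rw [hs]
        rintro (h' | h')
        · exact hl.1 (h' ▸ hy)
        · exact hj.2 (h' ▸ hy)
      rw [h1.apply_of_notMem hx' hy']
      exact hB x y (List.mem_cons_of_mem _ hx) (List.mem_cons_of_mem _ hy) hxy
    intro x y hx hy
    by_cases hxs : b x = s
    · refine h1.diag x (by rw [hs]; exact Or.inl hxs) y (by rw [hs]; exact Or.inr hy) ?_
      rintro rfl
      exact hj.1 (hy.symm.trans hxs)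
    · have hxl : b x ∈ l := (List.mem_cons.1 hx).resolve_left hxs
      have hx' : x ∉ pivotSet b (f s) := by
        rw [hs]
        rintro (h' | h')
        · exact hxs h'
        · exact hj.2 (h' ▸ hxl)
      obtain ⟨W, -, hW, hn, hCW⟩ := h1.exists_conj
      have hnj : NonsingularBlock b j W :=
        (hn j (by rcases hf s with hs | hs <;> simp [hs])).1
      have hv := hnj (fun z => if b z = j then B x z else 0) (fun z hz => if_neg hz) ?_
      · simpa [hy] using congrFun hv y
      · intro t ht
        have h0 := hC x t hxl ht
        rw [hCW, Matrix.mul_assoc, hW.conjTranspose_mul_apply_of_notMem _ _ hx', mul_apply] at h0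
        refine Eq.trans ?_ h0
        rw [vecMul, dotProduct]
        refine Finset.sum_congr rfl fun z _ => ?_
        by_cases hz : b z = j
        · simp [hz]
        · rw [if_neg hz, zero_mul]
          by_cases hzs : b z = s
          · rw [hB x z hx (by simp [hzs]) (by rwa [hzs]), zero_mul]
          · rw [hW _ _ (fun h' => ?_), one_apply_ne, mul_zero]
            · rintro rfl
              exact hz ht
            · have := h'.1
              rw [hs] at this
              exact this.elim hzs hz

theorem StationaryRun.blockDiagOn {O : List (Fin m × Fin m)} (h : StationaryRun b O B B')
    {S : Set (Fin m)} (hO : ∀ p ∈ O, p.1 ∈ S ∧ p.2 ∈ S) (hB : BlockDiagOn b S B) :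
    BlockDiagOn b S B' := by
  induction O generalizing B with
  | nil => exact (show B = B' from h) ▸ hB
  | cons p O ih =>
    obtain ⟨C, h1, h2⟩ := h
    have hp := hO p List.mem_cons_self
    exact ih h2 (fun q hq => hO q (List.mem_cons_of_mem _ hq)) (h1.blockDiagOn hp.1 hp.2 hB)

theorem StationaryRun.herm {O : List (Fin m × Fin m)} (h : StationaryRun b O B B') (hO : O ≠ []) :
    B.IsHermitian := by
  cases O with
  | nil => exact absurd rfl hO
  | cons p O => exact h.choose_spec.1.herm

/-- The blocks in `S` are decoupled, the columns in `J` are still to be processed in the order `lt`.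
With `lt` the order of `Fin m` this treats columns, with the opposite order it treats rows. -/
theorem StationaryRun.blockDiagOn_univ (lt : Fin m → Fin m → Prop) [Std.Asymm lt]
    (f : Fin m → Fin m → Fin m × Fin m) (hf : ∀ j r, f j r = (r, j) ∨ f j r = (j, r))
    (τ : Fin m → List (Fin m)) (hτ : ∀ j, (τ j).Nodup ∧ ∀ r, r ∈ τ j ↔ lt r j)
    (J : List (Fin m)) (S : Set (Fin m)) (hJ : J.Pairwise lt) (hS : ∀ j, j ∈ S ∨ j ∈ J)
    (hSJ : ∀ s ∈ S, ∀ j ∈ J, lt s j)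
    (h : StationaryRun b (J.flatMap fun j => (τ j).map (f j)) B B') (hB : BlockDiagOn b S B) :
    BlockDiagOn b Set.univ B' := by
  have irr : ∀ j, ¬ lt j j := fun j hj => Std.Asymm.asymm j j hj hj
  induction J generalizing B S with
  | nil =>
    have : S = Set.univ := Set.eq_univ_of_forall fun j => (hS j).resolve_right (by simp)
    subst this
    exact (show B = B' from h) ▸ hB
  | cons j J ih =>
    rw [List.flatMap_cons, stationaryRun_append] at h
    obtain ⟨C, h1, h2⟩ := h
    rw [List.pairwise_cons] at hJ
    have hτS : ∀ r, r ∈ τ j ↔ r ∈ S := by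
      intro r
      rw [(hτ j).2]
      refine ⟨fun hr => (hS r).resolve_right fun hr' => ?_, fun hr => hSJ r hr j List.mem_cons_self⟩
      rcases List.mem_cons.1 hr' with rfl | hr'
      · exact irr _ hr
      · exact Std.Asymm.asymm _ _ hr (hJ.1 r hr')
    have hjS : j ∉ S := fun h' => irr j (hSJ j h' j List.mem_cons_self)
    have hjτ : j ∉ τ j := fun h' => hjS ((hτS j).1 h')
    have hset : {r | r ∈ τ j} = S := by ext r; exact hτS r
    refine ih (insert j S) hJ.2 ?_ ?_ h2 ?_
    · intro i
      rcases hS i with hi | hi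
      · exact Or.inl (Set.mem_insert_of_mem _ hi)
      · rcases List.mem_cons.1 hi with rfl | hi
        · exact Or.inl (Set.mem_insert _ _)
        · exact Or.inr hi
    · rintro s (rfl | hs) i hi
      · exact hJ.1 i hi
      · exact hSJ s hs i (List.mem_cons_of_mem _ hi)
    · refine h1.blockDiagOn ?_ ?_
      · intro p hp
        obtain ⟨r, hr, rfl⟩ := List.mem_map.1 hp
        have := (hτS r).1 hr
        rcases hf j r with h' | h' <;> simp [h', this]
      · have hcol := h1.column_eq_zero (f j) (hf j) (τ j) (hτ j).1 hjτ (by rwa [hset])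
        have hcol' : ∀ x y, b x ∈ S → b y = j → B x y = 0 :=
          fun x y hx hy => hcol x y ((hτS _).2 hx) hy
        rintro x y (hx | hx) (hy | hy) hxy
        · exact absurd (hx.trans hy.symm) hxy
        · have hne : (τ j).map (f j) ≠ [] := by
            have := (hτS _).2 hy
            intro h'
            simp only [List.map_eq_nil_iff] at h'
            simp [h'] at this
          rw [← (h1.herm hne).apply, hcol' y x hy hx, star_zero]
        · exact hcol' x y hx hy
        · exact hB x y hx hy hxy

theorem StationaryRun.isDiag_of_columnSerial {O : List (Fin m × Fin m)} [Nontrivial (Fin m)]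
    (hO : ColumnSerial O) (h : StationaryRun b O B B') : B'.IsDiag := by
  obtain ⟨τ, hτ, rfl⟩ := hO
  rw [isDiag_iff_blocks b]
  refine ⟨h.blockDiagOn_univ (· < ·) (fun j r => (r, j)) (fun _ _ => Or.inl rfl) τ hτ _ ∅
    (List.pairwise_lt_finRange m) (by simp) (by simp) (by simp [BlockDiagOn]), fun r => ?_⟩
  obtain ⟨s, hs⟩ := exists_ne r
  rcases lt_or_gt_of_ne hs with hs | hs
  · exact h.diagOn_block (p := (s, r)) (by simpa using (hτ r).2 s |>.2 hs) (Or.inr rfl)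
  · exact h.diagOn_block (p := (r, s)) (by simpa using (hτ s).2 r |>.2 hs) (Or.inl rfl)

theorem StationaryRun.isDiag_of_rowSerial {O : List (Fin m × Fin m)} [Nontrivial (Fin m)]
    (hO : RowSerial O) (h : StationaryRun b O B B') : B'.IsDiag := by
  obtain ⟨τ, hτ, rfl⟩ := hO
  rw [isDiag_iff_blocks b]
  refine ⟨h.blockDiagOn_univ (· > ·) (fun j r => (j, r)) (fun _ _ => Or.inr rfl) τ hτ _ ∅
    (List.pairwise_reverse.2 (List.pairwise_lt_finRange m)) (by simp) (by simp)
    (by simp [BlockDiagOn]), fun r => ?_⟩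
  obtain ⟨s, hs⟩ := exists_ne r
  rcases lt_or_gt_of_ne hs with hs | hs
  · exact h.diagOn_block (p := (s, r)) (by simpa using (hτ s).2 r |>.2 hs) (Or.inr rfl)
  · exact h.diagOn_block (p := (r, s)) (by simpa using (hτ r).2 s |>.2 hs) (Or.inl rfl)

/-! ### Generalized serial orderings force a diagonal matrix -/

/-- Only a diagonal matrix can start an endless cyclic sequence of stationary runs through `O`. The
block map `b` is arbitrary, which allows the blocks to be relabelled. -/
def ForcesDiagonal (ι : Type*) [Fintype ι] [DecidableEq ι] (O : List (Fin m × Fin m)) : Prop :=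
  ∀ (b : ι → Fin m) (B : ℕ → Matrix ι ι ℂ),
    (∀ k, StationaryRun b O (B k) (B (k + 1))) → (B 0).IsDiag

theorem forcesDiagonal_of_serial {O : List (Fin m × Fin m)} [Nontrivial (Fin m)]
    (hO : SerialWithPermutations O) : ForcesDiagonal ι O := by
  intro b B hB
  rcases hO with h | h | h | h
  · exact (hB 0).isDiag_left ((hB 0).isDiag_of_columnSerial h)
  · exact (hB 0).reverse.isDiag_of_columnSerial h
  · exact (hB 0).isDiag_left ((hB 0).isDiag_of_rowSerial h)
  · exact (hB 0).reverse.isDiag_of_rowSerial h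

theorem ActsOn.commute {s t : Set ι} (hst : Disjoint s t) {W W' : Matrix ι ι ℂ}
    (h : ActsOn s W) (h' : ActsOn t W') : W * W' = W' * W := by
  have key : ∀ {s t : Set ι}, Disjoint s t → ∀ {W W' : Matrix ι ι ℂ}, ActsOn s W → ActsOn t W' →
      (W - 1) * (W' - 1) = 0 := by
    intro s t hst W W' h h'
    ext x y
    rw [mul_apply, Matrix.zero_apply]
    refine Finset.sum_eq_zero fun z _ => ?_
    by_cases hz : z ∈ s
    · rw [Matrix.sub_apply W', h' z y (fun h'' => Set.disjoint_left.1 hst hz h''.1), sub_self,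
        mul_zero]
    · rw [Matrix.sub_apply, h x z (fun h'' => hz h''.2), sub_self, zero_mul]
  have h1 := key hst h h'
  have h2 := key hst.symm h' h
  rw [← sub_eq_zero, ← h1.trans h2.symm |> sub_eq_zero.2]
  noncomm_ring

/-- Stationary steps with disjoint pivot pairs may be interchanged. -/
theorem StationaryStep.swap {C : Matrix ι ι ℂ} (h1 : StationaryStep b p B C)
    (h2 : StationaryStep b q C B') (hpq : Disjoint (pivotSet b p) (pivotSet b q)) :
    ∃ D, StationaryStep b q B D ∧ StationaryStep b p D B' := by
  obtain ⟨W, hW, hs, hn, hC⟩ := h1.exists_conj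
  obtain ⟨W', hW', hs', hn', hB'⟩ := h2.exists_conj
  have hdis : ∀ x, x ∈ pivotSet b q → x ∉ pivotSet b p := fun x hx hx' =>
    Set.disjoint_left.1 hpq hx' hx
  have hdis' : ∀ x, x ∈ pivotSet b p → x ∉ pivotSet b q := fun x hx hx' =>
    Set.disjoint_left.1 hpq hx hx'
  have hcomm := hs.commute hpq hs'
  have hBD : B' = Wᴴ * (W'ᴴ * B * W') * W := by
    rw [hB', hC]
    calc W'ᴴ * (Wᴴ * B * W) * W' = (W * W')ᴴ * B * (W * W') := by
          simp only [conjTranspose_mul, Matrix.mul_assoc]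
      _ = (W' * W)ᴴ * B * (W' * W) := by rw [hcomm]
      _ = _ := by simp only [conjTranspose_mul, Matrix.mul_assoc]
  refine ⟨W'ᴴ * B * W', ⟨h1.herm, ?_, ?_, W', hW', hs', hn', rfl⟩,
    ⟨isHermitian_conj h1.herm W', ?_, ?_, W, hW, hs, hn, hBD⟩⟩
  · intro x hx y hy hxy
    rw [← h1.apply_of_notMem (hdis x hx) (hdis y hy), h2.diag x hx y hy hxy]
  · intro x hx y hy hxy
    rw [← hs.conj_apply_of_notMem (W'ᴴ * B * W') (hdis x hx) (hdis y hy), ← hBD,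
      h2.diag' x hx y hy hxy]
  · intro x hx y hy hxy
    rw [hs'.conj_apply_of_notMem _ (hdis' x hx) (hdis' y hy), h1.diag x hx y hy hxy]
  · intro x hx y hy hxy
    rw [h2.apply_of_notMem (hdis' x hx) (hdis' y hy), h1.diag' x hx y hy hxy]

theorem ForcesDiagonal.of_admissibleTransposition {O O' : List (Fin m × Fin m)}
    (h : AdmissibleTransposition O O') (hO : ForcesDiagonal ι O') : ForcesDiagonal ι O := by
  obtain ⟨L, R, p, q, rfl, rfl, h1, h2, h3, h4⟩ := h
  intro b B hB
  refine hO b B fun k => ?_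
  have hpq : Disjoint (pivotSet b p) (pivotSet b q) := by
    rw [Set.disjoint_left]
    rintro x (hx | hx) (hx' | hx')
    · exact h1 (hx.symm.trans hx')
    · exact h2 (hx.symm.trans hx')
    · exact h3 (hx.symm.trans hx')
    · exact h4 (hx.symm.trans hx')
  obtain ⟨C, hL, D, hp, E, hq, hR⟩ := stationaryRun_append.1 (hB k)
  obtain ⟨F, hq', hp'⟩ := hp.swap hq hpq
  exact stationaryRun_append.2 ⟨C, hL, F, hq', E, hp', hR⟩

theorem ForcesDiagonal.of_shiftEquiv {O O' : List (Fin m × Fin m)}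
    (h : ShiftEquiv O O') (hO : ForcesDiagonal ι O') : ForcesDiagonal ι O := by
  obtain ⟨O₁, O₂, rfl, rfl⟩ := h
  intro b B hB
  choose C hC₁ hC₂ using fun k => stationaryRun_append.1 (hB k)
  exact (hC₁ 0).isDiag_left
    (hO b C fun k => stationaryRun_append.2 ⟨B (k + 1), hC₂ k, hC₁ (k + 1)⟩)

theorem ForcesDiagonal.of_weakEquiv {O O' : List (Fin m × Fin m)}
    (h : WeakEquiv O O') (hO : ForcesDiagonal ι O') : ForcesDiagonal ι O := by
  induction h using Relation.ReflTransGen.head_induction_on with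
  | refl => exact hO
  | head h _ ih =>
    rcases h with h | h
    · clear hO
      induction h using Relation.ReflTransGen.head_induction_on with
      | refl => exact ih
      | head h _ ih => exact ih.of_admissibleTransposition h
    · exact ih.of_shiftEquiv h

theorem ForcesDiagonal.of_permEquiv {O O' : List (Fin m × Fin m)}
    (h : PermEquiv O O') (hO : ForcesDiagonal ι O') : ForcesDiagonal ι O := by
  obtain ⟨σ, rfl⟩ := h
  intro b B hB
  refine hO (σ ∘ b) B fun k => ?_
  have hmm : ∀ (i j r : Fin m), σ r = min (σ i) (σ j) ∨ σ r = max (σ i) (σ j) ↔ r = i ∨ r = j := by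
    intro i j r
    rcases le_total (σ i) (σ j) with h | h
    · simp [h]
    · simp [h, or_comm]
  have hns : ∀ r W, NonsingularBlock b r W → NonsingularBlock (σ ∘ b) (σ r) W := by
    intro r W h v h1 h2
    exact h v (fun z hz => h1 z (by simpa using hz)) fun y hy => h2 y (by simpa using hy)
  have hset : ∀ p, pivotSet (σ ∘ b) (min (σ p.1) (σ p.2), max (σ p.1) (σ p.2))
      = pivotSet b p := fun p => Set.ext fun x => hmm p.1 p.2 (b x)
  have hstep : ∀ p X Y, StationaryStep b p X Y →
      StationaryStep (σ ∘ b) (min (σ p.1) (σ p.2), max (σ p.1) (σ p.2)) X Y := by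
    intro p X Y h
    refine ⟨h.herm, by rw [hset]; exact h.diag, by rw [hset]; exact h.diag', ?_⟩
    obtain ⟨W, hW, hs, hn, hY⟩ := h.exists_conj
    refine ⟨W, hW, by rwa [hset], fun r hr => ?_, hY⟩
    rw [← σ.apply_symm_apply r] at hr ⊢
    have := hn _ ((hmm _ _ _).1 hr)
    exact ⟨hns _ _ this.1, hns _ _ this.2⟩
  have hrun : ∀ (L : List (Fin m × Fin m)) X Y, StationaryRun b L X Y →
      StationaryRun (σ ∘ b) (L.map fun p => (min (σ p.1) (σ p.2), max (σ p.1) (σ p.2))) X Y := by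
    intro L
    induction L with
    | nil => exact fun X Y h => h
    | cons p L ih => exact fun X Y ⟨C, h1, h2⟩ => ⟨C, hstep p X C h1, ih C Y h2⟩
  exact hrun O _ _ (hB k)

theorem GeneralizedSerial.forcesDiagonal {O : List (Fin m × Fin m)} [Nontrivial (Fin m)]
    (hO : GeneralizedSerial O) : ForcesDiagonal ι O := by
  obtain ⟨-, O', O'', hs, ⟨h1, h2⟩ | ⟨h1, h2⟩⟩ := hO
  · exact ((forcesDiagonal_of_serial hs).of_weakEquiv h2).of_permEquiv h1
  · exact ((forcesDiagonal_of_serial hs).of_permEquiv h2).of_weakEquiv h1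

end Stationary

/-! ### Pivot submatrices and the bound on the cosines -/

section Pivot

variable {m : ℕ} {n : Fin m → ℕ}

/-- The embedding of the indices of the pivot submatrix `(i, j)` into those of the whole matrix. -/
def pivotIncl (n : Fin m → ℕ) (i j : Fin m) : PivotIdx n i j → BlockIdx n :=
  Sum.elim (fun a => ⟨i, a⟩) fun a => ⟨j, a⟩

theorem pivotIncl_injective {i j : Fin m} (h : i ≠ j) : Function.Injective (pivotIncl n i j) := by
  rintro (a | a) (a' | a') haa'
  · simpa [pivotIncl] using haa'
  · exact absurd (congrArg Sigma.fst haa') h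
  · exact absurd (congrArg Sigma.fst haa').symm h
  · simpa [pivotIncl] using haa'

theorem pivotSubmatrix_eq (V : BlockMatrix n) (i j : Fin m) :
    pivotSubmatrix V i j = V.submatrix (pivotIncl n i j) (pivotIncl n i j) := by
  ext (x | x) (y | y) <;> rfl

theorem range_pivotIncl (i j : Fin m) :
    Set.range (pivotIncl n i j) = pivotSet (Sigma.fst : BlockIdx n → Fin m) (i, j) := by
  ext ⟨r, a⟩
  constructor
  · rintro ⟨a | a, ha⟩
    · exact Or.inl (congrArg Sigma.fst ha).symm
    · exact Or.inr (congrArg Sigma.fst ha).symm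
  · rintro (h | h)
    · obtain rfl : r = i := h
      exact ⟨Sum.inl a, rfl⟩
    · obtain rfl : r = j := h
      exact ⟨Sum.inr a, rfl⟩

theorem IsElementary.actsOn_range {i j : Fin m} {V : BlockMatrix n} (h : IsElementary i j V) :
    ActsOn (Set.range (pivotIncl n i j)) V := by
  rw [range_pivotIncl]
  exact h

theorem sigmaMin_mul_norm_le {p : ℕ} (hp : 1 ≤ p) (V : Matrix (Fin p) (Fin p) ℂ)
    (x : EuclideanSpace ℂ (Fin p)) : sigmaMin V * ‖x‖ ≤ ‖Matrix.toEuclideanLin V x‖ := by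
  set T := Matrix.toEuclideanLin V
  have hfin : Module.finrank ℂ (EuclideanSpace ℂ (Fin p)) = p := by simp
  set hT := T.isSymmetric_adjoint_comp_self
  have hmin : ∀ i : Fin p, sigmaMin V ^ 2 ≤ hT.eigenvalues hfin i := by
    intro i
    rw [← T.sq_singularValues_fin hfin i]
    have h1 : T.singularValues (p - 1) ≤ T.singularValues i :=
      T.singularValues_antitone (by have := i.2; omega)
    exact pow_le_pow_left₀ (T.singularValues_nonneg _) h1 2
  set v := hT.eigenvectorBasis hfin
  have h1 : ‖T x‖ ^ 2 = ∑ i, hT.eigenvalues hfin i * ‖inner ℂ (v i) x‖ ^ 2 := by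
    have h2 : inner ℂ (T x) (T x) = inner ℂ x ((T.adjoint ∘ₗ T) x) := by
      rw [LinearMap.comp_apply, LinearMap.adjoint_inner_right]
    have h3 : ((‖T x‖ ^ 2 : ℝ) : ℂ)
        = ((∑ i, hT.eigenvalues hfin i * ‖inner ℂ (v i) x‖ ^ 2 : ℝ) : ℂ) := by
      have h4 := inner_self_eq_norm_sq_to_K (𝕜 := ℂ) (T x)
      rw [Complex.ofReal_pow]
      refine h4.symm.trans ?_
      rw [h2, ← v.sum_inner_mul_inner, Complex.ofReal_sum]
      refine Finset.sum_congr rfl fun i _ => ?_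
      have h5 : inner ℂ (v i) ((T.adjoint ∘ₗ T) x)
          = (hT.eigenvalues hfin i : ℂ) * inner ℂ (v i) x := by
        rw [← hT (v i) x, hT.apply_eigenvectorBasis hfin i, inner_smul_left]
        simp [v]
      rw [h5, ← inner_conj_symm x (v i), mul_left_comm, Complex.conj_mul']
      push_cast
      rfl
    exact_mod_cast h3
  have h6 : ‖x‖ ^ 2 = ∑ i, ‖inner ℂ (v i) x‖ ^ 2 := (v.sum_sq_norm_inner_right x).symm
  refine le_of_sq_le_sq ?_ (norm_nonneg _)
  rw [mul_pow, h1, h6, Finset.mul_sum]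
  exact Finset.sum_le_sum fun i _ => mul_le_mul_of_nonneg_right (hmin i) (by positivity)

theorem ubcGamma_pos (p q : ℕ) : 0 < ubcGamma p q := by
  refine lt_of_lt_of_le ?_ (le_max_right _ _)
  have : 0 < Nat.choose (p + q) p := Nat.choose_pos (Nat.le_add_right p q)
  positivity

theorem nonsingularBlock_of_det_ne_zero {r : Fin m} {W : BlockMatrix n}
    (h : (block W r r).det ≠ 0) : NonsingularBlock Sigma.fst r W := by
  intro v hv1 hv2
  have h1 : (fun a => v ⟨r, a⟩) = 0 := by
    refine Matrix.eq_zero_of_vecMul_eq_zero h ?_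
    ext a
    have := hv2 ⟨r, a⟩ rfl
    rw [vecMul, dotProduct, Fintype.sum_sigma, Finset.sum_eq_single r] at this
    · exact this
    · intro s _ hs
      exact Finset.sum_eq_zero fun z _ => by rw [hv1 ⟨s, z⟩ hs, zero_mul]
    · simp
  ext ⟨s, a⟩
  by_cases hs : s = r
  · subst hs
    exact congrFun h1 a
  · exact hv1 _ hs

/-- A lower bound on `σ_min` survives in the limit, so limits of UBC matrices have nonsingular
diagonal blocks. -/
theorem det_ne_zero_of_tendsto {p : ℕ} (hp : 1 ≤ p) {l : Filter ℕ} [l.NeBot]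
    {f : ℕ → Matrix (Fin p) (Fin p) ℂ} {L : Matrix (Fin p) (Fin p) ℂ} (hf : Tendsto f l (𝓝 L))
    {c : ℝ} (hc : 0 < c) (h : ∀ t, c ≤ sigmaMin (f t)) : L.det ≠ 0 := by
  intro hdet
  obtain ⟨x, hx0, hx⟩ := Matrix.exists_mulVec_eq_zero_iff.2 hdet
  have h1 : ∀ t, c * ‖WithLp.toLp 2 x‖ ≤ ‖WithLp.toLp 2 (f t *ᵥ x)‖ := fun t =>
    (mul_le_mul_of_nonneg_right (h t) (norm_nonneg _)).trans
      (sigmaMin_mul_norm_le hp (f t) (WithLp.toLp 2 x))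
  have hcont : Continuous fun M : Matrix (Fin p) (Fin p) ℂ => ‖WithLp.toLp 2 (M *ᵥ x)‖ := by
    fun_prop
  have h2 := ge_of_tendsto' ((hcont.tendsto L).comp hf) h1
  simp only [hx] at h2
  have h3 : 0 < ‖WithLp.toLp 2 x‖ := norm_pos_iff.2 (by simpa using hx0)
  have h4 : ‖WithLp.toLp 2 (0 : Fin p → ℂ)‖ = 0 := by simp
  nlinarith

end Pivot

/-! ### Convergence of the off-norm -/

section Limit

variable {ι : Type*} [Fintype ι] [DecidableEq ι]

theorem exists_tendsto_ultrafilter (F : Ultrafilter ℕ) (f : ℕ → Matrix ι ι ℂ) (C : ℝ)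
    (h : ∀ t x y, ‖f t x y‖ ≤ C) : ∃ L, Tendsto f F (𝓝 L) := by
  have h1 : ∀ x y, ∃ z : ℂ, Tendsto (fun t => f t x y) F (𝓝 z) := by
    intro x y
    obtain ⟨z, -, hz⟩ := (isCompact_closedBall (0 : ℂ) C).ultrafilter_le_nhds
      (F.map fun t => f t x y)
        (le_principal_iff.2 (Ultrafilter.mem_map.2 (univ_mem' fun t => by simpa using h t x y)))
    exact ⟨z, hz⟩
  choose L hL using h1
  exact ⟨Matrix.of L, tendsto_pi_nhds.2 fun x => tendsto_pi_nhds.2 fun y => hL x y⟩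

theorem continuous_off_sq : Continuous fun B : Matrix ι ι ℂ => off B ^ 2 := by
  simp only [off_sq_eq_sum]
  refine continuous_finsetSum _ fun x _ => continuous_finsetSum _ fun y _ => ?_
  split_ifs
  · exact continuous_const
  · fun_prop

theorem stationaryRun_of_steps {m : ℕ} {b : ι → Fin m} (O : List (Fin m × Fin m))
    (B : ℕ → Matrix ι ι ℂ) (a : ℕ)
    (h : ∀ k (hk : k < O.length), StationaryStep b O[k] (B (a + k)) (B (a + k + 1))) :
    StationaryRun b O (B a) (B (a + O.length)) := by
  induction O generalizing a with
  | nil => rfl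
  | cons p O ih =>
    refine ⟨B (a + 1), h 0 (by simp), ?_⟩
    have := ih (a + 1) fun k hk => by
      have := h (k + 1) (by simpa using hk)
      rwa [List.getElem_cons_succ, ← add_assoc, add_right_comm a k 1] at this
    rwa [List.length_cons, ← add_assoc, add_right_comm]

end Limit

section Off

variable {m : ℕ} {n : Fin m → ℕ} {I : ℕ → Fin m × Fin m} {A : BlockMatrix n}
  {Ak U : ℕ → BlockMatrix n}

theorem IsBlockJacobi.isHermitian (h : IsBlockJacobi n I A Ak U) (hA : A.IsHermitian) (k : ℕ) :
    (Ak k).IsHermitian := by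
  induction k with
  | zero => rw [h.init]; exact hA
  | succ k ih => rw [h.step]; exact isHermitian_conj ih _

theorem IsBlockJacobi.frobSq_eq (h : IsBlockJacobi n I A Ak U) (k : ℕ) :
    frobSq (Ak k) = frobSq A := by
  induction k with
  | zero => rw [h.init]
  | succ k ih => rw [h.step, frobSq_conj (h.unitary k), ih]

theorem IsBlockJacobi.charpoly_eq (h : IsBlockJacobi n I A Ak U) (k : ℕ) :
    (Ak k).charpoly = A.charpoly := by
  induction k with
  | zero => rw [h.init]
  | succ k ih => rw [h.step, charpoly_conj (h.unitary k), ih]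

theorem IsBlockJacobi.pivotSubmatrix_succ (h : IsBlockJacobi n I A Ak U) {k : ℕ}
    (hI : (I k).1 ≠ (I k).2) :
    pivotSubmatrix (Ak (k + 1)) (I k).1 (I k).2 =
      (pivotSubmatrix (U k) (I k).1 (I k).2)ᴴ * pivotSubmatrix (Ak k) (I k).1 (I k).2 *
        pivotSubmatrix (U k) (I k).1 (I k).2 := by
  rw [h.step]
  simp only [pivotSubmatrix_eq]
  exact (h.elementary k).actsOn_range.conj_submatrix (pivotIncl_injective hI) _

theorem IsBlockJacobi.off_sq_succ (h : IsBlockJacobi n I A Ak U) {k : ℕ}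
    (hI : (I k).1 ≠ (I k).2) :
    off (Ak (k + 1)) ^ 2 + off (pivotSubmatrix (Ak k) (I k).1 (I k).2) ^ 2 = off (Ak k) ^ 2 := by
  have hd := h.diagonalizes k
  rw [← h.pivotSubmatrix_succ hI, h.step, pivotSubmatrix_eq] at hd
  rw [h.step, pivotSubmatrix_eq]
  exact (h.elementary k).actsOn_range.off_sq_conj_add (pivotIncl_injective hI) (h.unitary k) _ hd

theorem diagOn_pivotSet_iff {B : BlockMatrix n} {p : Fin m × Fin m} (hp : p.1 ≠ p.2) :
    DiagOn (pivotSet Sigma.fst p) B ↔ (pivotSubmatrix B p.1 p.2).IsDiag := by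
  rw [pivotSubmatrix_eq, ← range_pivotIncl]
  constructor
  · intro h x y hxy
    exact h _ ⟨x, rfl⟩ _ ⟨y, rfl⟩ fun h' => hxy (pivotIncl_injective hp h')
  · rintro h _ ⟨x, rfl⟩ _ ⟨y, rfl⟩ hxy
    exact h fun h' => hxy (h' ▸ rfl)

/-- If the pivot pairs repeat cyclically an ordering which forces a diagonal matrix, then the block
Jacobi method with uniformly bounded cosines drives the off-norm to zero. -/
theorem IsBlockJacobi.tendsto_off (h : IsBlockJacobi n I A Ak U) (hA : A.IsHermitian)
    (hn : ∀ r, 1 ≤ n r) {O : List (Fin m × Fin m)} (hO : ForcesDiagonal (BlockIdx n) O)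
    (hO0 : 0 < O.length) (hOI : ∀ k, O[k % O.length]? = some (I k))
    (hlt : ∀ k, (I k).1 ≠ (I k).2) {ϱ : ℝ} (hϱ : 0 < ϱ)
    (hU : ∀ k, IsUBCE n ϱ (I k).1 (I k).2 (U k)) :
    Tendsto (fun k => off (Ak k)) atTop (𝓝 0) := by
  set T := O.length
  have hper : ∀ t k, I (t * T + k) = I k := by
    intro t k
    have := hOI (t * T + k)
    rw [Nat.mul_add_mod', hOI k] at this
    exact (Option.some_injective _ this).symm
  have hanti : Antitone fun k => off (Ak k) ^ 2 :=
    antitone_nat_of_succ_le fun k => by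
      have := h.off_sq_succ (hlt k)
      nlinarith [sq_nonneg (off (pivotSubmatrix (Ak k) (I k).1 (I k).2))]
  obtain ⟨l, hl⟩ : ∃ l, Tendsto (fun k => off (Ak k) ^ 2) atTop (𝓝 l) :=
    ⟨_, tendsto_atTop_ciInf hanti ⟨0, by rintro _ ⟨k, rfl⟩; exact sq_nonneg _⟩⟩
  have hpiv : Tendsto (fun k => off (pivotSubmatrix (Ak k) (I k).1 (I k).2) ^ 2) atTop (𝓝 0) := by
    have := hl.sub (hl.comp (tendsto_add_atTop_nat 1))
    rw [sub_self] at this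
    refine this.congr fun k => ?_
    have := h.off_sq_succ (hlt k)
    simp only [Function.comp]
    linarith
  let F : Ultrafilter ℕ := hyperfilter ℕ
  have hF : (F : Filter ℕ) ≤ atTop := Nat.hyperfilter_le_atTop
  have hT : ∀ k, Tendsto (fun t => t * T + k) F atTop := fun k =>
    (tendsto_atTop_mono (fun t => (Nat.le_mul_of_pos_right t hO0).trans (Nat.le_add_right _ k))
      tendsto_id).mono_left hF
  have hAb : ∀ k x y, ‖Ak k x y‖ ≤ √(frobSq A) := by
    intro k x y
    refine Real.le_sqrt_of_sq_le ?_
    rw [← h.frobSq_eq k]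
    exact norm_entry_sq_le_frobSq _ _ _
  -- Limits of the processes that start at the beginnings of the cycles.
  choose B hB using fun k =>
    exists_tendsto_ultrafilter F (fun t => Ak (t * T + k)) _ fun t => hAb _
  choose W hW using fun k =>
    exists_tendsto_ultrafilter F (fun t => U (t * T + k)) 1 fun t x y =>
      entry_norm_bound_of_unitary (h.unitary _) x y
  have hpivB : ∀ k, (pivotSubmatrix (B k) (I k).1 (I k).2).IsDiag := by
    intro k
    have h1 : Tendsto (fun t => off (pivotSubmatrix (Ak (t * T + k)) (I k).1 (I k).2) ^ 2) F
        (𝓝 0) := by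
      refine (hpiv.comp (hT k)).congr fun t => ?_
      rw [Function.comp_apply, hper]
    have hcont : Continuous fun M : BlockMatrix n =>
        off (pivotSubmatrix M (I k).1 (I k).2) ^ 2 := by
      simp only [pivotSubmatrix_eq]
      exact continuous_off_sq.comp (continuous_id.matrix_submatrix _ _)
    have h2 := tendsto_nhds_unique h1 ((hcont.tendsto _).comp (hB k))
    exact isDiag_of_off_eq_zero (sq_eq_zero_iff.1 h2.symm)
  have hpivB' : ∀ k, (pivotSubmatrix (B (k + 1)) (I k).1 (I k).2).IsDiag := by
    intro k x y hxy
    rw [pivotSubmatrix_eq, submatrix_apply]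
    have h1 : Tendsto (fun t => Ak (t * T + (k + 1)) (pivotIncl n (I k).1 (I k).2 x)
        (pivotIncl n (I k).1 (I k).2 y)) F (𝓝 (B (k + 1) _ _)) :=
      tendsto_pi_nhds.1 (tendsto_pi_nhds.1 (hB (k + 1)) _) _
    refine tendsto_nhds_unique h1 (tendsto_const_nhds.congr fun t => ?_)
    have h2 := h.diagonalizes (t * T + k)
    rw [← h.pivotSubmatrix_succ (hlt _), hper, pivotSubmatrix_eq] at h2
    exact (h2 hxy).symm
  have hstep : ∀ k, StationaryStep Sigma.fst (I k) (B k) (B (k + 1)) := by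
    intro k
    refine ⟨?_, (diagOn_pivotSet_iff (hlt k)).2 (hpivB k),
      (diagOn_pivotSet_iff (hlt k)).2 (hpivB' k), W k, ?_, ?_, ?_, ?_⟩
    · exact tendsto_nhds_unique (((continuous_id.matrix_conjTranspose).tendsto _).comp (hB k))
        ((hB k).congr fun t => ((h.isHermitian hA _)).symm)
    · rw [mem_unitaryGroup_iff]
      have hc : Continuous fun M : BlockMatrix n => M * Mᴴ := by fun_prop
      exact tendsto_nhds_unique ((hc.tendsto _).comp (hW k))
        (tendsto_const_nhds.congr fun t => (mem_unitaryGroup_iff.1 (h.unitary _)).symm)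
    · intro x y hxy
      refine tendsto_nhds_unique (tendsto_pi_nhds.1 (tendsto_pi_nhds.1 (hW k) x) y)
        (tendsto_const_nhds.congr fun t => ?_)
      have := h.elementary (t * T + k)
      rw [hper] at this
      exact (this x y hxy).symm
    · intro r hr
      have hdet : (block (W k) r r).det ≠ 0 := by
        refine det_ne_zero_of_tendsto (hn r)
          (f := fun t => block (U (t * T + k)) r r) (l := F)
          (((continuous_id.matrix_submatrix _ _).tendsto _).comp (hW k))
          (c := ϱ * ubcGamma (n (I k).1) (n (I k).2)) (mul_pos hϱ (ubcGamma_pos _ _)) fun t => ?_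
        have := hU (t * T + k)
        rw [hper] at this
        rcases hr with rfl | rfl
        · exact this.sigma_ge
        · exact this.sigma_eq ▸ this.sigma_ge
      refine ⟨nonsingularBlock_of_det_ne_zero hdet, nonsingularBlock_of_det_ne_zero ?_⟩
      have : block (W k)ᴴ r r = (block (W k) r r)ᴴ := rfl
      rw [this, det_conjTranspose]
      exact star_ne_zero.2 hdet
    · have h1 := ((hW k).star.mul (hB k)).mul (hW k)
      refine tendsto_nhds_unique (hB (k + 1)) (h1.congr fun t => ?_)
      exact (h.step (t * T + k)).symm
  have hdiag : (B 0).IsDiag := by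
    have := hO Sigma.fst (fun k => B (k * T)) fun k => by
      have := stationaryRun_of_steps (b := Sigma.fst) O B (k * T) fun r hr => by
        have h1 := hstep (k * T + r)
        have h2 := hOI r
        rw [Nat.mod_eq_of_lt hr, List.getElem?_eq_getElem hr] at h2
        rwa [hper, ← Option.some_injective _ h2] at h1
      rwa [show k * T + O.length = (k + 1) * T by simp only [T]; ring] at this
    simpa using this
  have hl0 : l = 0 := by
    have h1 := (continuous_off_sq.tendsto _).comp (hB 0)
    rw [off_eq_zero_of_isDiag hdiag] at h1
    have h2 := tendsto_nhds_unique h1 (hl.comp (hT 0))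
    simpa using h2.symm
  rw [hl0] at hl
  have := hl.sqrt
  simpa [Real.sqrt_sq (off_nonneg _)] using this

end Off

/-! ### Almost diagonal matrices -/

section Near

variable {ι κ : Type*} [Fintype ι] [DecidableEq ι] [Fintype κ] [DecidableEq κ]

theorem exists_perm_of_charpoly_diagonal {A : Matrix ι ι ℂ} (hA : A.IsHermitian) {d : ι → ℂ}
    (h : (diagonal d).charpoly = A.charpoly) :
    ∃ σ : Equiv.Perm ι, ∀ x, d x = hA.eigenvalues (σ x) := by
  rw [charpoly_diagonal, hA.charpoly_eq] at h
  have h1 := congrArg Polynomial.roots h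
  rw [Polynomial.roots_prod _ _ (Finset.prod_ne_zero_iff.2 fun _ _ => Polynomial.X_sub_C_ne_zero _),
    Polynomial.roots_prod _ _ (Finset.prod_ne_zero_iff.2 fun _ _ => Polynomial.X_sub_C_ne_zero _)]
    at h1
  simp only [Polynomial.roots_X_sub_C, Multiset.bind_singleton] at h1
  have h2 : ∀ z : ℂ, Nonempty ({x // d x = z} ≃ {x // (hA.eigenvalues x : ℂ) = z}) := by
    intro z
    refine ⟨Fintype.equivOfCardEq ?_⟩
    have := congrArg (Multiset.count z) h1
    rw [Multiset.count_map, Multiset.count_map] at this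
    rw [Fintype.card_subtype, Fintype.card_subtype]
    simp only [eq_comm (b := z)]
    exact this
  exact ⟨Equiv.ofFiberEquiv fun z => (h2 z).some, fun x =>
    (Equiv.ofFiberEquiv_map (fun z => (h2 z).some) x).symm⟩

/-- By compactness, the diagonal of an almost diagonal matrix with the characteristic polynomial of
`A` is, up to order, close to the list of the eigenvalues of `A`. -/
theorem exists_perm_near_of_off_le {A : Matrix ι ι ℂ} (hA : A.IsHermitian) {δ : ℝ} (hδ : 0 < δ) :
    ∃ ε > 0, ∀ B : Matrix ι ι ℂ, frobSq B = frobSq A → B.charpoly = A.charpoly → off B ≤ ε →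
      ∃ σ : Equiv.Perm ι, ∀ x, ‖B x x - hA.eigenvalues (σ x)‖ ≤ δ := by
  by_contra! hcon
  choose B hB1 hB2 hB3 hB4 using fun t : ℕ => hcon (1 / ((t : ℝ) + 1)) (by positivity)
  let F : Ultrafilter ℕ := hyperfilter ℕ
  have hF : (F : Filter ℕ) ≤ atTop := Nat.hyperfilter_le_atTop
  obtain ⟨L, hL⟩ := exists_tendsto_ultrafilter F B (√(frobSq A)) fun t x y => by
    refine Real.le_sqrt_of_sq_le ?_
    rw [← hB1 t]
    exact norm_entry_sq_le_frobSq _ _ _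
  have hoff : Tendsto (fun t => off (B t)) F (𝓝 0) :=
    (squeeze_zero (fun t => off_nonneg _) hB3 tendsto_one_div_add_atTop_nhds_zero_nat).mono_left hF
  have hL0 : L.IsDiag := by
    refine isDiag_of_off_eq_zero (sq_eq_zero_iff.1 ?_)
    refine tendsto_nhds_unique ((continuous_off_sq.tendsto L).comp hL) ?_
    simpa [Function.comp_def] using hoff.pow 2
  have hchar : L.charpoly = A.charpoly := by
    refine Polynomial.funext fun z => ?_
    rw [eval_charpoly, eval_charpoly]
    have hc : Continuous fun M : Matrix ι ι ℂ => (scalar ι z - M).det := by fun_prop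
    refine tendsto_nhds_unique ((hc.tendsto L).comp hL) (tendsto_const_nhds.congr fun t => ?_)
    rw [Function.comp_apply, ← eval_charpoly, ← eval_charpoly, hB2]
  rw [← hL0.diagonal_diag] at hchar
  obtain ⟨σ, hσ⟩ := exists_perm_of_charpoly_diagonal hA hchar
  have hev : ∀ᶠ t in (F : Filter ℕ), ∀ x, ‖B t x x - hA.eigenvalues (σ x)‖ < δ := by
    rw [eventually_all]
    intro x
    have h1 : Tendsto (fun t => B t x x) F (𝓝 (L x x)) :=
      tendsto_pi_nhds.1 (tendsto_pi_nhds.1 hL x) x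
    rw [← hσ x]
    have := Metric.tendsto_nhds.1 h1 δ hδ
    simpa [dist_eq_norm] using this
  obtain ⟨t, ht⟩ := hev.exists
  obtain ⟨x, hx⟩ := hB4 t σ
  exact absurd (ht x) (not_lt.2 hx.le)

/-! ### Jacobi rotations -/

theorem ActsOn.mem_unitaryGroup {e : κ → ι} (he : Function.Injective e)
    {W : Matrix ι ι ℂ} (h : ActsOn (Set.range e) W)
    (hW : W.submatrix e e ∈ unitaryGroup κ ℂ) : W ∈ unitaryGroup ι ℂ := by
  rw [mem_unitaryGroup_iff', star_eq_conjTranspose]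
  ext x y
  by_cases hx : x ∈ Set.range e
  · by_cases hy : y ∈ Set.range e
    · obtain ⟨x, rfl⟩ := hx
      obtain ⟨y, rfl⟩ := hy
      have h1 := h.conj_submatrix he 1
      rw [Matrix.mul_one, submatrix_one _ he, Matrix.mul_one, ← star_eq_conjTranspose,
        ← star_eq_conjTranspose, mem_unitaryGroup_iff'.1 hW] at h1
      have h2 := congrFun (congrFun h1 x) y
      rw [submatrix_apply, star_eq_conjTranspose] at h2
      rw [h2, one_apply, one_apply]
      simp only [he.eq_iff]
    · rw [h.mul_apply_of_notMem _ _ hy, h.conjTranspose _ _ fun h' => hy h'.2]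
  · rw [h.conjTranspose_mul_apply_of_notMem _ _ hx, h _ _ fun h' => hx h'.1]

theorem rotation_actsOn (p q : ι) (α φ : ℝ) : ActsOn {p, q} (rotation p q α φ) := by
  intro x y hxy
  simp only [Set.mem_insert_iff, Set.mem_singleton_iff, not_and_or, not_or] at hxy
  simp only [rotation, of_apply]
  rw [if_neg (by tauto), if_neg (by tauto), if_neg (by tauto), if_neg (by tauto)]

theorem rotation_submatrix {e : κ → ι} (he : Function.Injective e) (p q : κ) (α φ : ℝ) :
    (rotation (e p) (e q) α φ).submatrix e e = rotation p q α φ := by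
  ext x y
  simp only [rotation, of_apply, submatrix_apply, one_apply, he.eq_iff]

theorem rotation_submatrix_pair {p q : ι} (hpq : p ≠ q) (α φ : ℝ) :
    (rotation p q α φ).submatrix ![p, q] ![p, q] =
      !![(Real.cos φ : ℂ), -(Complex.exp (α * Complex.I) * (Real.sin φ : ℂ));
        Complex.exp (-(α * Complex.I)) * (Real.sin φ : ℂ), (Real.cos φ : ℂ)] := by
  ext x y
  fin_cases x <;> fin_cases y <;> simp [rotation, hpq, hpq.symm]

/-- The congruence by a plane rotation, where `w` is the phase of the pivot entry. -/
theorem rotation_congruence_two (a d h c s : ℝ) {w w' : ℂ} (hw : w * w' = 1) :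
    (!![(c : ℂ), w * s; -(w' * s), c] * !![(a : ℂ), h * w; h * w', d] *
      !![(c : ℂ), -(w * s); w' * s, c] : Matrix (Fin 2) (Fin 2) ℂ) =
    !![((c ^ 2 * a + 2 * c * s * h + s ^ 2 * d : ℝ) : ℂ),
        w * ((h * (c ^ 2 - s ^ 2) - c * s * (a - d) : ℝ) : ℂ);
      w' * ((h * (c ^ 2 - s ^ 2) - c * s * (a - d) : ℝ) : ℂ),
        ((s ^ 2 * a - 2 * c * s * h + c ^ 2 * d : ℝ) : ℂ)] := by
  ext x y
  fin_cases x <;> fin_cases y <;> simp [mul_apply, Fin.sum_univ_two]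
  · linear_combination (2 * c * s * h + s ^ 2 * d : ℂ) * hw
  · linear_combination (-(w * h * s ^ 2) : ℂ) * hw
  · linear_combination (-(w' * h * s ^ 2) : ℂ) * hw
  · linear_combination (-2 * c * s * h + s ^ 2 * a : ℂ) * hw

theorem pair_injective {p q : ι} (hpq : p ≠ q) : Function.Injective ![p, q] := by
  intro x y hxy
  fin_cases x <;> fin_cases y <;> simp_all

theorem range_pair (p q : ι) : Set.range ![p, q] = {p, q} := by
  ext x
  simp [eq_comm, or_comm]

/-- A Jacobi rotation annihilates its pivot entry `S_pq` and moves the diagonal entries by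
`|S_pq| |tan φ| ≤ |S_pq|`. -/
theorem IsJacobiRotation.spec {S R : Matrix ι ι ℂ} (h : IsJacobiRotation S R)
    (hS : S.IsHermitian) : R ∈ unitaryGroup ι ℂ ∧ off (Rᴴ * S * R) ≤ off S ∧
      ∀ x, ‖(Rᴴ * S * R) x x - S x x‖ ≤ off S := by
  obtain ⟨p, q, φ, hpq, hφ1, hφ2, heq, rfl⟩ := h
  set α := Complex.arg (S p q)
  set R := rotation p q α φ
  set c := Real.cos φ
  set s := Real.sin φ
  set w := Complex.exp (α * Complex.I)
  set w' := Complex.exp (-(α * Complex.I))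
  set e : Fin 2 → ι := ![p, q]
  have he : Function.Injective e := pair_injective hpq
  have hw : w * w' = 1 := by rw [← Complex.exp_add, add_neg_cancel, Complex.exp_zero]
  have hw' : star w = w' := by
    simp only [w, w', RCLike.star_def, ← Complex.exp_conj, map_mul, Complex.conj_I,
      Complex.conj_ofReal, mul_neg]
  have hw'' : star w' = w := by rw [← hw', star_star]
  have hcs : c ^ 2 + s ^ 2 = 1 := Real.cos_sq_add_sin_sq φ
  have hR : ActsOn (Set.range e) R := by
    rw [range_pair]
    exact rotation_actsOn p q α φ
  have hR2 : R.submatrix e e = !![(c : ℂ), -(w * s); w' * s, c] := rotation_submatrix_pair hpq α φ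
  have hR2' : (R.submatrix e e)ᴴ = !![(c : ℂ), w * s; -(w' * s), c] := by
    rw [hR2]
    ext x y
    fin_cases x <;> fin_cases y <;> simp [conjTranspose_apply, hw', hw'']
  have hS2 : S.submatrix e e = !![((S p p).re : ℂ), ‖S p q‖ * w; ‖S p q‖ * w', (S q q).re] := by
    have h1 : S p q = ‖S p q‖ * w := (Complex.norm_mul_exp_arg_mul_I _).symm
    have h2 : S q p = ‖S p q‖ * w' := by
      rw [← hS.apply, ← hw']
      exact (congrArg star h1).trans (by simp)
    have h3 : ∀ x, S x x = (S x x).re := fun x => (hS.coe_re_apply_self x).symm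
    ext x y
    fin_cases x <;> fin_cases y <;> simp [e]
    · exact h3 p
    · exact h1
    · exact h2
    · exact h3 q
  have hconj := hR.conj_submatrix he S
  rw [hR2', hS2, hR2, rotation_congruence_two _ _ _ c s hw] at hconj
  have hzero : ‖S p q‖ * (c ^ 2 - s ^ 2) - c * s * ((S p p).re - (S q q).re) = 0 := by
    rw [Real.sin_two_mul, Real.cos_two_mul'] at heq
    linarith
  have hU : R ∈ unitaryGroup ι ℂ := by
    refine hR.mem_unitaryGroup he ?_
    rw [mem_unitaryGroup_iff', star_eq_conjTranspose, hR2', hR2]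
    have := rotation_congruence_two 1 1 0 c s hw
    have h1 : (!![((1 : ℝ) : ℂ), ((0 : ℝ) : ℂ) * w; ((0 : ℝ) : ℂ) * w', ((1 : ℝ) : ℂ)] :
        Matrix (Fin 2) (Fin 2) ℂ) = 1 := by
      ext x y
      fin_cases x <;> fin_cases y <;> simp
    rw [h1, Matrix.mul_one] at this
    rw [this]
    ext x y
    fin_cases x <;> fin_cases y <;> simp <;> norm_cast <;> linarith
  have hdiag : ((Rᴴ * S * R).submatrix e e).IsDiag := by
    rw [hconj, hzero]
    intro x y hxy
    fin_cases x <;> fin_cases y <;> simp_all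
  have hoff := hR.off_sq_conj_add he hU S hdiag
  refine ⟨hU, le_of_sq_le_sq (by nlinarith [sq_nonneg (off (S.submatrix e e))]) (off_nonneg _), ?_⟩
  have hc0 : 0 ≤ c := Real.cos_nonneg_of_mem_Icc
    ⟨by linarith [Real.pi_pos], by linarith [Real.pi_pos]⟩
  have hc2 : s ^ 2 ≤ c ^ 2 := by
    have : 0 ≤ Real.cos (2 * φ) := Real.cos_nonneg_of_mem_Icc ⟨by linarith, by linarith⟩
    rw [Real.cos_two_mul'] at this
    linarith
  have hcpos : 0 < c := by
    rcases hc0.lt_or_eq with h | h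
    · exact h
    · rw [← h] at hcs hc2
      nlinarith
  have hs : |s| ≤ c := abs_le_of_sq_le_sq hc2 hc0
  set t := 2 * c * s * ‖S p q‖ - s ^ 2 * ((S p p).re - (S q q).re)
  have ht : |t| ≤ ‖S p q‖ := by
    have h1 : c * t = s * ‖S p q‖ := by
      simp only [t]
      linear_combination s * hzero + (s * ‖S p q‖) * hcs
    have h2 : c * |t| ≤ c * ‖S p q‖ := by
      rw [← abs_of_pos hcpos, ← abs_mul, abs_of_pos hcpos, h1, abs_mul,
        abs_of_nonneg (norm_nonneg _)]
      exact mul_le_mul_of_nonneg_right hs (norm_nonneg _)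
    exact le_of_mul_le_mul_left h2 hcpos
  have ht' : |t| ≤ off S := ht.trans (norm_le_off hpq)
  intro x
  by_cases hx : x ∈ Set.range e
  · obtain ⟨i, rfl⟩ := hx
    have h1 := congrFun (congrFun hconj i) i
    have h2 := congrFun (congrFun hS2 i) i
    rw [submatrix_apply] at h1 h2
    rw [h1, h2]
    fin_cases i
    · have : ((c ^ 2 * (S p p).re + 2 * c * s * ‖S p q‖ + s ^ 2 * (S q q).re : ℝ) : ℂ)
          - ((S p p).re : ℂ) = (t : ℝ) := by
        rw [← Complex.ofReal_sub]
        congr 1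
        simp only [t]
        linear_combination (S p p).re * hcs
      refine le_of_eq_of_le (congrArg norm this) ?_
      rwa [Complex.norm_real, Real.norm_eq_abs]
    · have : ((s ^ 2 * (S p p).re - 2 * c * s * ‖S p q‖ + c ^ 2 * (S q q).re : ℝ) : ℂ)
          - ((S q q).re : ℂ) = (-t : ℝ) := by
        rw [← Complex.ofReal_sub]
        congr 1
        simp only [t]
        linear_combination (S q q).re * hcs
      refine le_of_eq_of_le (congrArg norm this) ?_
      rwa [Complex.norm_real, Real.norm_eq_abs, abs_neg]
  · rw [hR.conj_apply_of_notMem _ hx hx, sub_self, norm_zero]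
    exact off_nonneg _

theorem IsJacobiRotation.exists_extension {e : κ → ι} (he : Function.Injective e)
    {B : Matrix ι ι ℂ} {R : Matrix κ κ ℂ} (h : IsJacobiRotation (B.submatrix e e) R) :
    ∃ R' : Matrix ι ι ℂ, IsJacobiRotation B R' ∧ ActsOn (Set.range e) R' ∧
      R'.submatrix e e = R := by
  obtain ⟨p, q, φ, hpq, hφ1, hφ2, heq, rfl⟩ := h
  refine ⟨_, ⟨e p, e q, φ, he.ne hpq, hφ1, hφ2, heq, rfl⟩, ?_, rotation_submatrix he p q _ φ⟩
  intro x y hxy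
  refine rotation_actsOn _ _ _ _ x y fun h' => hxy ⟨?_, ?_⟩
  · rcases h'.1 with h | h <;> exact h ▸ Set.mem_range_self _
  · rcases h'.2 with h | h <;> exact h ▸ Set.mem_range_self _

end Near

/-! ### The core algorithm on an almost diagonal matrix -/

section Core

variable {ι κ : Type*} [Fintype ι] [DecidableEq ι] [Fintype κ] [DecidableEq κ]

/-- Each plane rotation moves the diagonal by less than the gap between two eigenvalues, so during a
run of the core algorithm no diagonal entry can leave its eigenvalue. The run on the pivot submatrix
is carried along as a run on the whole matrix, whose spectrum is known. -/
theorem IsCoreOutput.exists_diagonal {e : κ → ι} (he : Function.Injective e) {B : Matrix ι ι ℂ}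
    (hB : B.IsHermitian) {V : Matrix κ κ ℂ} (hV : IsCoreOutput (B.submatrix e e) V)
    {lam c : ι → ℝ} {δ g : ℝ} (hg : 3 * δ < g)
    (hgap : ∀ x y, lam x ≠ lam y → g ≤ |lam x - lam y|) (hc : ∀ x, ∃ y, c x = lam y)
    (hnear : ∀ B' : Matrix ι ι ℂ, frobSq B' = frobSq B → B'.charpoly = B.charpoly →
      off B' ≤ off B → ∀ x, ∃ y, ‖B' x x - lam y‖ ≤ δ)
    (hoff : off B ≤ δ) (hBc : ∀ x, ‖B x x - c x‖ ≤ δ) :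
    V ∈ unitaryGroup κ ℂ ∧ ∃ d : κ → ℂ, Vᴴ * B.submatrix e e * V = diagonal d ∧
      ∀ x, ‖d x - c (e x)‖ ≤ δ := by
  obtain ⟨S, R, hS0, hSR, ⟨d, hd⟩, hclus⟩ := hV
  have hrun : ∀ l, ∃ C : Matrix ι ι ℂ, C.submatrix e e = S l ∧ C.IsHermitian ∧
      frobSq C = frobSq B ∧ C.charpoly = B.charpoly ∧ off C ≤ off B ∧
      ∀ x, ‖C x x - c x‖ ≤ δ := by
    intro l
    induction l with
    | zero => exact ⟨B, hS0.symm, hB, rfl, rfl, le_rfl, hBc⟩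
    | succ l ih =>
      obtain ⟨C, hC1, hC2, hC3, hC4, hC5, hC6⟩ := ih
      obtain ⟨hR, hSl⟩ := hSR l
      rw [← hC1] at hR
      obtain ⟨R', hR', hact, hsub⟩ := hR.exists_extension he
      obtain ⟨hu, ho, hm⟩ := hR'.spec hC2
      refine ⟨R'ᴴ * C * R', ?_, isHermitian_conj hC2 R', (frobSq_conj hu C).trans hC3,
        (charpoly_conj hu C).trans hC4, ho.trans hC5, fun x => ?_⟩
      · rw [hact.conj_submatrix he, hsub, hC1, hSl]
      · obtain ⟨y, hy⟩ := hnear (R'ᴴ * C * R') ((frobSq_conj hu C).trans hC3)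
          ((charpoly_conj hu C).trans hC4) (ho.trans hC5) x
        obtain ⟨z, hz⟩ := hc x
        have heq : lam y = lam z := by
          by_contra hne
          have h1 := hgap y z hne
          have h2 : |lam y - lam z| ≤ 3 * δ := by
            rw [← Real.norm_eq_abs, ← Complex.norm_real, Complex.ofReal_sub, ← hz]
            calc ‖(lam y : ℂ) - c x‖ = ‖-((R'ᴴ * C * R') x x - lam y)
                  + ((R'ᴴ * C * R') x x - C x x) + (C x x - c x)‖ := by congr 1; ring
              _ ≤ ‖-((R'ᴴ * C * R') x x - lam y)‖ + ‖(R'ᴴ * C * R') x x - C x x‖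
                  + ‖C x x - c x‖ := norm_add₃_le
              _ ≤ δ + δ + δ := by
                  rw [norm_neg]
                  exact add_le_add (add_le_add hy ((hm x).trans (hC5.trans hoff))) (hC6 x)
              _ = 3 * δ := by ring
          linarith
        rwa [hz, ← heq]
  have hunit : ∀ l, ((List.range l).map R).prod ∈ unitaryGroup κ ℂ ∧
      (((List.range l).map R).prod)ᴴ * S 0 * ((List.range l).map R).prod = S l := by
    intro l
    induction l with
    | zero => simp
    | succ l ih =>
      obtain ⟨C, hC1, hC2, -⟩ := hrun l
      have hR : R l ∈ unitaryGroup κ ℂ :=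
        ((hSR l).1.spec (hC1 ▸ hC2.submatrix e)).1
      rw [List.range_succ, List.map_append, List.prod_append, List.map_singleton,
        List.prod_singleton]
      refine ⟨mul_mem ih.1 hR, ?_⟩
      rw [(hSR l).2, ← ih.2, conjTranspose_mul]
      simp only [Matrix.mul_assoc]
  obtain ⟨F, hF, hFV⟩ := mapClusterPt_iff_ultrafilter.1 hclus
  refine ⟨?_, d, ?_, fun x => ?_⟩
  · rw [mem_unitaryGroup_iff]
    have hcont : Continuous fun M : Matrix κ κ ℂ => M * Mᴴ := by fun_prop
    exact tendsto_nhds_unique ((hcont.tendsto _).comp hFV)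
      (tendsto_const_nhds.congr fun l => (mem_unitaryGroup_iff.1 (hunit l).1).symm)
  · have hcont : Continuous fun M : Matrix κ κ ℂ => Mᴴ * B.submatrix e e * M := by fun_prop
    refine tendsto_nhds_unique ((hcont.tendsto _).comp hFV) ((hd.mono_left hF).congr fun l => ?_)
    rw [Function.comp_apply, ← hS0, (hunit l).2]
  · have h1 : Tendsto (fun l => S l x x) atTop (𝓝 (d x)) := by
      simpa using tendsto_pi_nhds.1 (tendsto_pi_nhds.1 hd x) x
    refine le_of_tendsto' ((h1.sub_const (c (e x) : ℂ)).norm) fun l => ?_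
    obtain ⟨C, hC1, -, -, -, -, hC6⟩ := hrun l
    rw [← hC1]
    exact hC6 (e x)

/-- Eigenvectors of an almost diagonal matrix have small components where the diagonal is far from
the eigenvalue. -/
theorem norm_entry_mul_le_of_diagonalizes {B V : Matrix κ κ ℂ} {d : κ → ℂ}
    (hV : V ∈ unitaryGroup κ ℂ) (h : Vᴴ * B * V = diagonal d) (x y : κ) :
    ‖B x x - d y‖ * ‖V x y‖ ≤ Fintype.card κ * off B := by
  have h1 : B * V = V * diagonal d := by
    rw [← h, ← Matrix.mul_assoc, ← Matrix.mul_assoc, ← star_eq_conjTranspose,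
      mem_unitaryGroup_iff.1 hV, Matrix.one_mul]
  have h2 := congrFun (congrFun h1 x) y
  rw [mul_diagonal, mul_apply, ← Finset.add_sum_erase _ _ (Finset.mem_univ x)] at h2
  have h3 : (B x x - d y) * V x y = -∑ z ∈ Finset.univ.erase x, B x z * V z y := by
    linear_combination h2
  rw [← norm_mul, h3, norm_neg]
  refine (norm_sum_le_of_le _ (f := fun z => B x z * V z y) (n := fun _ => off B)
    fun z hz => ?_).trans ?_
  · rw [norm_mul]
    calc ‖B x z‖ * ‖V z y‖ ≤ off B * 1 :=
          mul_le_mul (norm_le_off (Finset.ne_of_mem_erase hz).symm)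
            (entry_norm_bound_of_unitary hV z y) (norm_nonneg _) (off_nonneg _)
      _ = off B := mul_one _
  · rw [Finset.sum_const, nsmul_eq_mul]
    refine mul_le_mul_of_nonneg_right ?_ (off_nonneg _)
    exact_mod_cast Finset.card_le_univ _

end Core

/-! ### Column pivoting -/

section Pivoting

variable {p q : ℕ}

theorem mul_swapProduct_apply {o : Type*} [Fintype o] (t : Fin p → Fin p ⊕ Fin q) (L : List (Fin p))
    (M : Matrix o (Fin p ⊕ Fin q) ℂ) (x : o) {y : Fin p ⊕ Fin q}
    (hy : ∀ s ∈ L, y ≠ Sum.inl s ∧ y ≠ t s) : (M * swapProduct t L) x y = M x y := by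
  induction L generalizing M with
  | nil => simp [swapProduct]
  | cons s L ih =>
    have hs := hy s List.mem_cons_self
    have h1 : swapProduct t (s :: L) = swap ℂ (Sum.inl s) (t s) * swapProduct t L := by
      simp [swapProduct]
    rw [h1, ← Matrix.mul_assoc, ih _ fun r hr => hy r (List.mem_cons_of_mem _ hr),
      mul_swap_of_ne hs.1 hs.2]

theorem swapProduct_mem_unitaryGroup (t : Fin p → Fin p ⊕ Fin q) (L : List (Fin p)) :
    swapProduct t L ∈ unitaryGroup (Fin p ⊕ Fin q) ℂ := by
  refine list_prod_mem fun M hM => ?_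
  obtain ⟨r, -, rfl⟩ := List.mem_map.1 hM
  rw [mem_unitaryGroup_iff, star_eq_conjTranspose, conjTranspose_swap, swap_mul_self]

/-- If the columns of `V_ij` are short, column pivoting never selects one of them: a selected column
bounds the norms of all remaining columns, while each row of the triangular factor has norm one. -/
theorem IsColumnPivoting.isLeft {V : Matrix (Fin p ⊕ Fin q) (Fin p ⊕ Fin q) ℂ}
    (hV : V ∈ unitaryGroup (Fin p ⊕ Fin q) ℂ) {t : Fin p → Fin p ⊕ Fin q}
    (ht : IsColumnPivoting V t) {η : ℝ} (hη : ∀ s c, ‖V (Sum.inl s) (Sum.inr c)‖ ≤ η)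
    (hsmall : ((p : ℝ) + q) * (p * η ^ 2) < 1) (r : Fin p) : (t r).isLeft := by
  induction r using WellFoundedLT.induction with
  | ind r ih =>
  obtain ⟨hle, Q, T, hQ, hQT, htri, hpiv⟩ := ht
  by_contra hr
  obtain ⟨c, hc⟩ : ∃ c, t r = Sum.inr c := by
    rcases h : t r with a | c
    · simp [h] at hr
    · exact ⟨c, rfl⟩
  set M : Matrix (Fin p) (Fin p ⊕ Fin q) ℂ := V.submatrix Sum.inl id
  set E := swapProduct t (List.finRange p)
  have hE : E ∈ unitaryGroup (Fin p ⊕ Fin q) ℂ := swapProduct_mem_unitaryGroup _ _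
  have hQ1 : Q * Qᴴ = 1 := mem_unitaryGroup_iff.1 hQ
  have hQ2 : Qᴴ * Q = 1 := mem_unitaryGroup_iff'.1 hQ
  have hT : T = Qᴴ * (M * E) := by rw [hQT, ← Matrix.mul_assoc, hQ2, Matrix.one_mul]
  -- Column `r` of the permuted matrix is the selected column `c` of `V_ij`.
  have hcol : ∀ s, (M * E) s (Sum.inl r) = V (Sum.inl s) (Sum.inr c) := by
    intro s
    obtain ⟨L₁, L₂, hL⟩ := List.append_of_mem (List.mem_finRange r)
    have hsort := List.pairwise_lt_finRange p
    rw [hL, List.pairwise_append, List.pairwise_cons] at hsort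
    have hE' : E = swapProduct t L₁ * (swap ℂ (Sum.inl r) (t r) * swapProduct t L₂) := by
      simp [E, hL, swapProduct]
    rw [hE', ← Matrix.mul_assoc, ← Matrix.mul_assoc, mul_swapProduct_apply, mul_swap_apply_left,
      hc, mul_swapProduct_apply]
    · rfl
    · intro r' hr'
      refine ⟨Sum.inr_ne_inl, fun h => ?_⟩
      have := ih r' (hsort.2.2 r' hr' r List.mem_cons_self)
      simp [← h] at this
    · intro r' hr'
      have hlt := hsort.2.1.1 r' hr'
      refine ⟨fun h => hlt.ne (Sum.inl_injective h), fun h => ?_⟩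
      exact absurd (hle r' r h.symm) (not_le.2 hlt)
  have hcolnorm : ∑ s, ‖T s (Sum.inl r)‖ ^ 2 ≤ p * η ^ 2 := by
    have h1 : Tᴴ * T = (M * E)ᴴ * (M * E) := by
      rw [hT, conjTranspose_mul, conjTranspose_conjTranspose, Matrix.mul_assoc,
        ← Matrix.mul_assoc Q, hQ1, Matrix.one_mul]
    have h2 : ∀ N : Matrix (Fin p) (Fin p ⊕ Fin q) ℂ,
        ((∑ s, ‖N s (Sum.inl r)‖ ^ 2 : ℝ) : ℂ) = (Nᴴ * N) (Sum.inl r) (Sum.inl r) := by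
      intro N
      rw [mul_apply, Complex.ofReal_sum]
      refine Finset.sum_congr rfl fun s _ => ?_
      rw [conjTranspose_apply, RCLike.star_def, Complex.conj_mul', Complex.ofReal_pow]
    have h3 : ∑ s, ‖T s (Sum.inl r)‖ ^ 2 = ∑ s, ‖(M * E) s (Sum.inl r)‖ ^ 2 := by
      have := (h2 T).trans ((congrFun (congrFun h1 _) _).trans (h2 (M * E)).symm)
      exact_mod_cast this
    rw [h3]
    calc ∑ s, ‖(M * E) s (Sum.inl r)‖ ^ 2 ≤ ∑ _s : Fin p, η ^ 2 := by
          refine Finset.sum_le_sum fun s _ => ?_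
          rw [hcol]
          exact pow_le_pow_left₀ (norm_nonneg _) (hη s c) 2
      _ = p * η ^ 2 := by simp
  have hrow : ∑ c', ‖T r c'‖ ^ 2 = 1 := by
    have h1 : T * Tᴴ = 1 := by
      have h2 : M * Mᴴ = 1 := by
        have h3 : M * Mᴴ = (V * Vᴴ).submatrix Sum.inl Sum.inl := by
          ext x y
          simp [M, mul_apply]
        rw [h3, ← star_eq_conjTranspose, mem_unitaryGroup_iff.1 hV,
          submatrix_one _ Sum.inl_injective]
      have h4 : E * Eᴴ = 1 := mem_unitaryGroup_iff.1 hE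
      calc T * Tᴴ = Qᴴ * (M * (E * Eᴴ) * Mᴴ) * Q := by
            rw [hT]
            simp only [conjTranspose_mul, conjTranspose_conjTranspose, Matrix.mul_assoc]
        _ = 1 := by rw [h4, Matrix.mul_one, h2, Matrix.mul_one, hQ2]
    have h2 : ((∑ c', ‖T r c'‖ ^ 2 : ℝ) : ℂ) = (T * Tᴴ) r r := by
      rw [mul_apply, Complex.ofReal_sum]
      refine Finset.sum_congr rfl fun s _ => ?_
      rw [conjTranspose_apply, RCLike.star_def, Complex.mul_conj', Complex.ofReal_pow]
    rw [h1, one_apply_eq] at h2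
    exact_mod_cast h2
  have hpivot : ‖T r (Sum.inl r)‖ ^ 2 ≤ p * η ^ 2 :=
    (Finset.single_le_sum (f := fun s => ‖T s (Sum.inl r)‖ ^ 2) (fun _ _ => by positivity)
      (Finset.mem_univ r)).trans hcolnorm
  have hentry : ∀ c', ‖T r c'‖ ^ 2 ≤ p * η ^ 2 := by
    intro c'
    by_cases hc' : ∀ s : Fin p, c' = Sum.inl s → r ≤ s
    · refine le_trans ?_ ((hpiv r c' hc').trans hpivot)
      exact Finset.single_le_sum (f := fun s => ‖T s c'‖ ^ 2) (fun _ _ => by positivity)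
        (Finset.mem_Ici.2 le_rfl)
    · push Not at hc'
      obtain ⟨s, rfl, hs⟩ := hc'
      rw [htri s r hs, norm_zero, zero_pow two_ne_zero]
      positivity
  have : (1 : ℝ) ≤ ((p : ℝ) + q) * (p * η ^ 2) := by
    rw [← hrow]
    refine (Finset.sum_le_sum fun c' _ => hentry c').trans ?_
    simp
  linarith

theorem HasAttributeR.eq_one {V P : Matrix (Fin p ⊕ Fin q) (Fin p ⊕ Fin q) ℂ}
    (h : HasAttributeR V P) (hV : V ∈ unitaryGroup (Fin p ⊕ Fin q) ℂ) {η : ℝ}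
    (hη : ∀ s c, ‖V (Sum.inl s) (Sum.inr c)‖ ≤ η)
    (hsmall : ((p : ℝ) + q) * (p * η ^ 2) < 1) : P = 1 := by
  obtain ⟨t, ht, rfl⟩ := h
  rw [List.dropWhile_eq_nil_iff.2 fun r _ => ht.isLeft hV hη hsmall r]
  simp [swapProduct]

end Pivoting

/-! ### Convergence of the iterates -/

section Convergence

theorem exists_pos_le_of_finite {α : Type*} [Finite α] (f : α → ℝ) :
    ∃ g > 0, ∀ a, 0 < f a → g ≤ f a := by
  rcases isEmpty_or_nonempty α with h | h
  · exact ⟨1, one_pos, fun a => isEmptyElim a⟩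
  · obtain ⟨a, ha⟩ := Finite.exists_min fun a => if 0 < f a then f a else 1
    refine ⟨if 0 < f a then f a else 1, by split_ifs <;> first | assumption | exact one_pos, ?_⟩
    intro b hb
    simpa [hb] using ha b

theorem isAffiliated_of_near {ι : Type*} [Fintype ι] [DecidableEq ι] {A : Matrix ι ι ℂ}
    (hA : A.IsHermitian) {g δ : ℝ} (hg : 2 * δ ≤ g)
    (hgap : ∀ x y, hA.eigenvalues x ≠ hA.eigenvalues y →
      g ≤ |hA.eigenvalues x - hA.eigenvalues y|)
    {a : ℂ} {x : ι} (ha : ‖a - hA.eigenvalues x‖ ≤ δ) : IsAffiliated hA a (hA.eigenvalues x) := by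
  refine ⟨⟨x, rfl⟩, fun y => ?_⟩
  by_cases hxy : hA.eigenvalues x = hA.eigenvalues y
  · rw [hxy]
  · have h1 := hgap x y hxy
    rw [← Real.norm_eq_abs, ← Complex.norm_real, Complex.ofReal_sub] at h1
    have h2 := norm_sub_le_norm_sub_add_norm_sub (hA.eigenvalues x : ℂ) a (hA.eigenvalues y)
    rw [norm_sub_rev _ a] at h2
    linarith

variable {m : ℕ} {n : Fin m → ℕ} {I : ℕ → Fin m × Fin m} {A : BlockMatrix n}
  {Ak U : ℕ → BlockMatrix n}

/-- Close to the diagonal, a step of the method keeps every diagonal entry at its eigenvalue.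
Entries in different pivot blocks belong to different eigenvalues, hence `V_ij` is small and
attribute R yields `P = I`; the core algorithm itself does not interchange eigenvalues. -/
theorem IsBlockJacobi.diag_near_succ (h : IsBlockJacobi n I A Ak U) (hA : A.IsHermitian)
    {k : ℕ} (hlt : (I k).1 ≠ (I k).2)
    {V P : Matrix (PivotIdx n (I k).1 (I k).2) (PivotIdx n (I k).1 (I k).2) ℂ}
    (hcore : IsCoreOutput (pivotSubmatrix (Ak k) (I k).1 (I k).2) V)
    (hVP : pivotSubmatrix (U k) (I k).1 (I k).2 = V * P) (hR : HasAttributeR V P)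
    (hblock : ∀ μ : ℝ, IsMultipleEigenvalue hA μ →
      ∃ r : Fin m, ∀ x : BlockIdx n, IsAffiliated hA (Ak k x x) μ → x.1 = r)
    {g δ η : ℝ} (hδ : 0 < δ) (hg : 4 * δ < g)
    (hgap : ∀ x y, hA.eigenvalues x ≠ hA.eigenvalues y →
      g ≤ |hA.eigenvalues x - hA.eigenvalues y|)
    (hnear : ∀ B : BlockMatrix n, frobSq B = frobSq A → B.charpoly = A.charpoly →
      off B ≤ off (Ak k) → ∃ τ : Equiv.Perm (BlockIdx n), ∀ x,
        ‖B x x - hA.eigenvalues (τ x)‖ ≤ δ)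
    (hoffδ : off (Ak k) ≤ δ) (hη : 0 < η)
    (hη1 : (Fintype.card (BlockIdx n) : ℝ) * η < 1)
    (hoffη : Fintype.card (BlockIdx n) * off (Ak k) ≤ δ * η)
    {σ : Equiv.Perm (BlockIdx n)} (hσ : ∀ x, ‖Ak k x x - hA.eigenvalues (σ x)‖ ≤ δ)
    (x : BlockIdx n) : ‖Ak (k + 1) x x - hA.eigenvalues (σ x)‖ ≤ δ := by
  set e := pivotIncl n (I k).1 (I k).2
  have he : Function.Injective e := pivotIncl_injective hlt
  have hcore' := hcore
  rw [pivotSubmatrix_eq] at hcore'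
  obtain ⟨hV, d, hd, hdσ⟩ := hcore'.exists_diagonal he (h.isHermitian hA k)
    (lam := hA.eigenvalues) (c := fun x => hA.eigenvalues (σ x)) (δ := δ) (g := g) (by linarith)
    hgap (fun x => ⟨σ x, rfl⟩)
    (fun B hB1 hB2 hB3 y =>
      have ⟨τ, hτ⟩ := hnear B (hB1.trans (h.frobSq_eq k)) (hB2.trans (h.charpoly_eq k)) hB3
      ⟨τ y, hτ y⟩)
    hoffδ hσ
  have hcard : ((n (I k).1 : ℝ) + n (I k).2) ≤ Fintype.card (BlockIdx n) := by
    have := Fintype.card_le_of_injective e he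
    rw [Fintype.card_sum, Fintype.card_fin, Fintype.card_fin] at this
    exact_mod_cast this
  have hoffpiv : off ((Ak k).submatrix e e) ≤ off (Ak k) := by
    refine le_of_sq_le_sq ?_ (off_nonneg _)
    have := h.off_sq_succ hlt
    rw [pivotSubmatrix_eq] at this
    nlinarith [sq_nonneg (off (Ak (k + 1)))]
  have hVsmall : ∀ s c, ‖V (Sum.inl s) (Sum.inr c)‖ ≤ η := by
    intro s c
    have hne : hA.eigenvalues (σ (e (Sum.inl s))) ≠ hA.eigenvalues (σ (e (Sum.inr c))) := by
      intro heq
      obtain ⟨r, hr⟩ := hblock _ ⟨σ (e (Sum.inl s)), σ (e (Sum.inr c)),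
        fun h' => Sum.inl_ne_inr (he (σ.injective h')), rfl, heq.symm⟩
      have h1 := hr _ (isAffiliated_of_near hA (by linarith) hgap (hσ (e (Sum.inl s))))
      have h2 : IsAffiliated hA (Ak k (e (Sum.inr c)) (e (Sum.inr c)))
          (hA.eigenvalues (σ (e (Sum.inl s)))) := by
        rw [heq]
        exact isAffiliated_of_near hA (by linarith) hgap (hσ (e (Sum.inr c)))
      exact hlt (h1.trans (hr _ h2).symm)
    have h1 := hgap _ _ hne
    have h2 := hσ (e (Sum.inl s))
    have h3 := hdσ (Sum.inr c)
    rw [← Real.norm_eq_abs, ← Complex.norm_real, Complex.ofReal_sub] at h1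
    have h4 : 2 * δ ≤ ‖(Ak k).submatrix e e (Sum.inl s) (Sum.inl s) - d (Sum.inr c)‖ := by
      have h5 := norm_sub_le_norm_sub_add_norm_sub
        (hA.eigenvalues (σ (e (Sum.inl s))) : ℂ) (Ak k (e (Sum.inl s)) (e (Sum.inl s)))
        (hA.eigenvalues (σ (e (Sum.inr c))))
      have h6 := norm_sub_le_norm_sub_add_norm_sub (Ak k (e (Sum.inl s)) (e (Sum.inl s)))
        (d (Sum.inr c)) (hA.eigenvalues (σ (e (Sum.inr c))) : ℂ)
      rw [norm_sub_rev] at h2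
      rw [submatrix_apply]
      linarith
    have h5 := norm_entry_mul_le_of_diagonalizes hV hd (Sum.inl s) (Sum.inr c)
    have h6 : (Fintype.card (PivotIdx n (I k).1 (I k).2) : ℝ) * off ((Ak k).submatrix e e)
        ≤ δ * η := by
      refine le_trans (mul_le_mul ?_ hoffpiv (off_nonneg _) (Nat.cast_nonneg _)) hoffη
      exact_mod_cast Fintype.card_le_of_injective e he
    have h7 : 2 * δ * ‖V (Sum.inl s) (Sum.inr c)‖ ≤ δ * η :=
      (mul_le_mul_of_nonneg_right h4 (norm_nonneg _)).trans (h5.trans h6)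
    nlinarith [norm_nonneg (V (Sum.inl s) (Sum.inr c))]
  have hP : P = 1 := by
    refine hR.eq_one hV hVsmall ?_
    have h1 : ((n (I k).1 : ℝ) + n (I k).2) * η < 1 :=
      (mul_le_mul_of_nonneg_right hcard hη.le).trans_lt hη1
    have h2 : (n (I k).1 : ℝ) * η ≤ ((n (I k).1 : ℝ) + n (I k).2) * η :=
      mul_le_mul_of_nonneg_right (by simp) hη.le
    have h3 : 0 ≤ (n (I k).1 : ℝ) * η := by positivity
    calc ((n (I k).1 : ℝ) + n (I k).2) * (n (I k).1 * η ^ 2)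
        = (((n (I k).1 : ℝ) + n (I k).2) * η) * (n (I k).1 * η) := by ring
      _ < 1 := by nlinarith
  have hsucc := h.pivotSubmatrix_succ hlt
  rw [hVP, hP, Matrix.mul_one, pivotSubmatrix_eq, pivotSubmatrix_eq] at hsucc
  by_cases hx : x ∈ Set.range e
  · obtain ⟨z, rfl⟩ := hx
    have h1 := congrFun (congrFun (hsucc.trans hd) z) z
    rw [submatrix_apply, diagonal_apply_eq] at h1
    exact h1 ▸ hdσ z
  · rw [h.step, (h.elementary k).actsOn_range.conj_apply_of_notMem _ hx hx]
    exact hσ x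

theorem IsBlockJacobi.convergesToEigenvalues (h : IsBlockJacobi n I A Ak U) (hA : A.IsHermitian)
    (hlt : ∀ k, (I k).1 ≠ (I k).2)
    {V P : ∀ k, Matrix (PivotIdx n (I k).1 (I k).2) (PivotIdx n (I k).1 (I k).2) ℂ}
    (hcore : ∀ k, IsCoreOutput (pivotSubmatrix (Ak k) (I k).1 (I k).2) (V k))
    (hVP : ∀ k, pivotSubmatrix (U k) (I k).1 (I k).2 = V k * P k)
    (hR : ∀ k, HasAttributeR (V k) (P k))
    (hoff : Tendsto (fun k => off (Ak k)) atTop (𝓝 0)) {k₀ : ℕ}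
    (hblock : ∀ k, k₀ ≤ k → ∀ μ : ℝ, IsMultipleEigenvalue hA μ →
      ∃ r : Fin m, ∀ x : BlockIdx n, IsAffiliated hA (Ak k x x) μ → x.1 = r) :
    ConvergesToEigenvalues hA Ak := by
  obtain ⟨g, hg0, hg⟩ := exists_pos_le_of_finite fun xy : BlockIdx n × BlockIdx n =>
    |hA.eigenvalues xy.1 - hA.eigenvalues xy.2|
  have hgap : ∀ x y, hA.eigenvalues x ≠ hA.eigenvalues y →
      g ≤ |hA.eigenvalues x - hA.eigenvalues y| := fun x y hxy =>
    hg (x, y) (abs_pos.2 (sub_ne_zero.2 hxy))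
  set N : ℝ := (Fintype.card (BlockIdx n) : ℝ)
  have hN : 0 ≤ N := Nat.cast_nonneg _
  set δ := g / 8
  have hδ : 0 < δ := by positivity
  set η := 1 / (N + 1)
  have hη : 0 < η := by positivity
  have hη1 : N * η < 1 := by
    rw [mul_one_div, div_lt_one (by positivity)]
    linarith
  obtain ⟨ε, hε, hnear⟩ := exists_perm_near_of_off_le hA hδ
  have hoffN : Tendsto (fun k => N * off (Ak k)) atTop (𝓝 0) := by
    simpa using hoff.const_mul N
  obtain ⟨K, hK⟩ := eventually_atTop.1 <| (hoff.eventually_le_const hε).and <|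
    (hoff.eventually_le_const hδ).and <|
      (hoffN.eventually_le_const (mul_pos hδ hη)).and (eventually_ge_atTop k₀)
  obtain ⟨σ, hσ⟩ := hnear (Ak K) (h.frobSq_eq K) (h.charpoly_eq K) (hK K le_rfl).1
  have hall : ∀ k, K ≤ k → ∀ x, ‖Ak k x x - hA.eigenvalues (σ x)‖ ≤ δ := by
    intro k hk
    induction k, hk using Nat.le_induction with
    | base => exact hσ
    | succ k hk ih =>
      obtain ⟨h1, h2, h3, h4⟩ := hK k hk
      exact h.diag_near_succ hA (hlt k) (hcore k) (hVP k) (hR k) (hblock k h4) hδ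
        (by simp only [δ]; linarith) hgap (fun B hB1 hB2 hB3 => hnear B hB1 hB2 (hB3.trans h1)) h2
        hη hη1 h3 ih
  refine ⟨σ, tendsto_pi_nhds.2 fun x => tendsto_pi_nhds.2 fun y => ?_⟩
  by_cases hxy : x = y
  · subst hxy
    rw [diagonal_apply_eq, Metric.tendsto_atTop]
    intro δ' hδ'
    obtain ⟨ε', hε', hnear'⟩ := exists_perm_near_of_off_le hA (δ := min δ (δ' / 2)) (by positivity)
    obtain ⟨K', hK'⟩ := eventually_atTop.1 <|
      (hoff.eventually_le_const hε').and (eventually_ge_atTop K)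
    refine ⟨K', fun k hk => ?_⟩
    obtain ⟨h1, h2⟩ := hK' k hk
    obtain ⟨τ, hτ⟩ := hnear' (Ak k) (h.frobSq_eq k) (h.charpoly_eq k) h1
    -- The finer approximation names the same eigenvalue, since both are within `δ` of the entry.
    have heq : hA.eigenvalues (σ x) = hA.eigenvalues (τ x) := by
      by_contra hne
      have h3 := hgap _ _ hne
      rw [← Real.norm_eq_abs, ← Complex.norm_real, Complex.ofReal_sub] at h3
      have h4 := norm_sub_le_norm_sub_add_norm_sub (hA.eigenvalues (σ x) : ℂ) (Ak k x x)
        (hA.eigenvalues (τ x))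
      have h5 := hall k h2 x
      rw [norm_sub_rev] at h5
      have h6 := (hτ x).trans (min_le_left _ _)
      simp only [δ] at h5 h6
      linarith
    rw [dist_eq_norm, heq]
    exact ((hτ x).trans (min_le_right _ _)).trans_lt (half_lt_self hδ')
  · rw [diagonal_apply_ne _ hxy]
    exact squeeze_zero_norm (fun k => norm_le_off hxy) hoff

end Convergence

end BlockJacobi

theorem mainTheorem1 {m : ℕ} (n : Fin m → ℕ) (hn : ∀ r, 1 ≤ n r)
    (I : ℕ → Fin m × Fin m) (hI : BlockJacobi.IsGeneralizedSerialStrategy I)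
    (A : BlockJacobi.BlockMatrix n) (hA : A.IsHermitian)
    (Ak U : ℕ → BlockJacobi.BlockMatrix n)
    (hAk : BlockJacobi.IsBlockJacobi n I A Ak U)
    (ϱ : ℝ) (hϱ0 : 0 < ϱ) (hϱ1 : ϱ ≤ 1)
    (hU : ∀ k, BlockJacobi.IsUBCE n ϱ (I k).1 (I k).2 (U k))
    (V P : ∀ k, Matrix (BlockJacobi.PivotIdx n (I k).1 (I k).2)
      (BlockJacobi.PivotIdx n (I k).1 (I k).2) ℂ)
    (hcore : ∀ k, BlockJacobi.IsCoreOutput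
      (BlockJacobi.pivotSubmatrix (Ak k) (I k).1 (I k).2) (V k))
    (hP : ∀ k, ∃ σ : Equiv.Perm (BlockJacobi.PivotIdx n (I k).1 (I k).2),
      P k = σ.permMatrix ℂ)
    (hVP : ∀ k, BlockJacobi.pivotSubmatrix (U k) (I k).1 (I k).2 = V k * P k) :
    Filter.Tendsto (fun k => BlockJacobi.off (Ak k)) Filter.atTop (nhds 0) ∧
    (Function.Injective hA.eigenvalues →
      (∀ k, BlockJacobi.HasAttributeR (V k) (P k)) →
      BlockJacobi.ConvergesToEigenvalues hA Ak) ∧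
    ((∀ k, BlockJacobi.HasAttributeR (V k) (P k)) →
      (∃ k₀ : ℕ, ∀ k, k₀ ≤ k → ∀ μ : ℝ, BlockJacobi.IsMultipleEigenvalue hA μ →
        ∃ r : Fin m, ∀ x : BlockJacobi.BlockIdx n,
          BlockJacobi.IsAffiliated hA (Ak k x x) μ → x.1 = r) →
      BlockJacobi.ConvergesToEigenvalues hA Ak) := by
  obtain ⟨O, hO, hOI⟩ := hI
  have hlt : ∀ k, (I k).1 < (I k).2 := fun k =>
    (hO.1.2 (I k)).1 (List.mem_of_getElem? (hOI k))
  have hO0 : 0 < O.length := by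
    have := List.mem_of_getElem? (hOI 0)
    exact List.length_pos_of_mem this
  have : Nontrivial (Fin m) := ⟨(I 0).1, (I 0).2, (hlt 0).ne⟩
  have hoff := hAk.tendsto_off hA hn hO.forcesDiagonal hO0 hOI (fun k => (hlt k).ne) hϱ0 hU
  refine ⟨hoff, fun hinj hR => ?_, fun hR ⟨k₀, hk₀⟩ => ?_⟩
  · refine hAk.convergesToEigenvalues hA (fun k => (hlt k).ne) hcore hVP hR hoff (k₀ := 0) ?_
    rintro k - μ ⟨x, y, hxy, hx, hy⟩
    exact absurd (hinj (hx.trans hy.symm)) hxy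
  · exact hAk.convergesToEigenvalues hA (fun k => (hlt k).ne) hcore hVP hR hoff hk₀
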